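/- Let $d\ge 1$, $0<\alpha<1$, and let $m$ be Lebesgue measure on $\mathbb{R}^d$ and $\|\cdot\|$ the Euclidean norm. Let $\Lambda_\alpha(\mathbb{R}^d)$ be the class of functions $f:\mathbb{R}^d\to\mathbb{R}$ for which there is a constant $C>0$ with $|f(x)-f(y)|\le C\|x-y\|^\alpha$ for all $x,y\in\mathbb{R}^d$; the infimum of these constants is denoted by $\|f\|_\alpha$. For $f\in\Lambda_\alpha(\mathbb{R}^d)$ and $0<\varepsilon<1/2$ put $$\Theta_\varepsilon(f)(x)=\int_{\{\varepsilon\le\|h\|\le 1\}}\frac{f(x+h)-f(x-h)}{\|h\|^{\alpha}}\,\frac{dm(h)}{\|h\|^{d}},\qquad x\in\mathbb{R}^d,$$ and, for a unit vector $e\in\mathbb{R}^d$, let $$\Theta^{e}_\varepsilon(f)(x)=\int_{\{\varepsilon\le\|h\|\le 1,\ \langle e,h\rangle>0\}}\frac{f(x+h)-f(x-h)}{\|h\|^{\alpha}}\,\frac{dm(h)}{\|h\|^{d}},\qquad x\in\mathbb{R}^d.$$ (The integrand is odd in $h$, so $\Theta_\varepsilon(f)$ vanishes identically; the half-annulus integral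 $\Theta^e_\varepsilon(f)$ in general does not, and for $d=1$, $e=1$ it is $\int_\varepsilon^1 (f(x+h)-f(x-h))\,h^{-\alpha-1}\,dh$.) Then there is a constant $c=c(\alpha,d)>0$, depending only on $\alpha$ and $d$, such that for every $f\in\Lambda_\alpha(\mathbb{R}^d)$ the following hold with $T_\varepsilon=\Theta_\varepsilon$, and also with $T_\varepsilon=\Theta^e_\varepsilon$ for every unit vector $e$: (a) For every $0<\varepsilon<1/2$ and every closed cube $Q\subset\mathbb{R}^d$ (of any position and orientation) with $m(Q)=1$, the function $|T_\varepsilon(f)|^2$ is integrable on $Q$ and $$\int_Q|T_\varepsilon(f)(x)|^2\,dm(x)\le c\,\log(1/\varepsilon)\,\|f\|_\alpha^2 .$$ (b) For almost every $x\in\mathbb{R}^d$, $$\limsup_{\varepsilon\to0^+}\frac{|T_\varepsilon(f)(x)|}{\sqrt{\log(1/\varepsilon)\,\log\log\log(1/\varepsilon)}}\le c\,\|f\|_\alpha .$$ -/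

import Mathlib

open MeasureTheory Filter Topology
open scoped NNReal

noncomputable section

/-- The integral of `(f (x + h) - f (x - h)) / ‖h‖ ^ (α + d)` over the annulus `ε ≤ ‖h‖ ≤ 1`
of `ℝ^d`. -/
def theta {d : ℕ} (α : ℝ≥0) (ε : ℝ) (f : EuclideanSpace ℝ (Fin d) → ℝ)
    (x : EuclideanSpace ℝ (Fin d)) : ℝ :=
  ∫ h in {h : EuclideanSpace ℝ (Fin d) | ε ≤ ‖h‖ ∧ ‖h‖ ≤ 1},
    (f (x + h) - f (x - h)) / ‖h‖ ^ (α : ℝ) / ‖h‖ ^ d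

/-- The same integral over the half annulus on the side of the vector `e`. For `d = 1` and `e = 1`
it is the integral of `(f (x + h) - f (x - h)) / h ^ (α + 1)` over `ε ≤ h ≤ 1`. -/
def halfTheta {d : ℕ} (e : EuclideanSpace ℝ (Fin d)) (α : ℝ≥0) (ε : ℝ)
    (f : EuclideanSpace ℝ (Fin d) → ℝ) (x : EuclideanSpace ℝ (Fin d)) : ℝ :=
  ∫ h in {h : EuclideanSpace ℝ (Fin d) | (ε ≤ ‖h‖ ∧ ‖h‖ ≤ 1) ∧ 0 < inner ℝ e h},
    (f (x + h) - f (x - h)) / ‖h‖ ^ (α : ℝ) / ‖h‖ ^ d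

/-- A closed cube in `ℝ^d`, with any position, orientation and side length `s > 0`. -/
def IsCube {d : ℕ} (Q : Set (EuclideanSpace ℝ (Fin d))) : Prop :=
  ∃ s : ℝ, 0 < s ∧ ∃ φ : EuclideanSpace ℝ (Fin d) ≃ᵢ EuclideanSpace ℝ (Fin d),
    Q = φ '' {x | ∀ i, 0 ≤ x i ∧ x i ≤ s}

end

/-! Along `ε = 2 ^ (-n)` the truncated integrals behave like a dyadic martingale with bounded
increments, up to a bounded error. About `log (1 / ε)` steps lead down to scale `ε`; hence a mean
square of order `log (1 / ε)` and, by the upper half of the law of the iterated logarithm, almost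
everywhere growth at most `√(n log log n)` with `n` of order `log (1 / ε)`.

Let `F n` be the integral truncated at `2 ^ (-n)` and let `Q` be a dyadic cube of side `l = 2 ^
(-n)`. Two estimates show that the mean of `F N` over `Q`, `N ≥ n`, is within a constant of `F n` on
`Q`. Increments `‖h‖ ≥ l`: moving `x` inside `Q` changes the integrand by at most a multiple of `l ^
α * ‖h‖ ^ (-α - d)`, whose integral is bounded because `α > 0` (`abs_oddInt_sub_le`). Increments
`‖h‖ ≤ l`: averaging over `Q` first replaces the Hölder bound by one linear in `‖h‖`, because the
translates of `Q` by `h` and `-h` differ only in thin slabs (`abs_setIntegral_translate_le`); the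
resulting weight `‖h‖ ^ (1 - α - d)` is integrable at the origin because `α < 1`
(`abs_setIntegral_oddInt_le`). `isApproxMartingale_truncOddInt` combines them.

For each fixed `N`, the conditional expectations of `F N` form a true martingale with bounded
increments up to time `N`. Exponential moments and Doob's maximal inequality then give both
conclusions. The parity of the kernel enters only through differences of `f`, so the set `A` of
increments is arbitrary, and the annulus and half annuli are treated at once. -/

/-- The integral of the odd difference of `f` at `x` against `‖h‖ ^ (-α - d)` over the set `S`
of increments. -/
noncomputable def oddInt {d : ℕ} (α : ℝ) (S : Set (EuclideanSpace ℝ (Fin d)))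
    (f : EuclideanSpace ℝ (Fin d) → ℝ) (x : EuclideanSpace ℝ (Fin d)) : ℝ :=
  ∫ h in S, (f (x + h) - f (x - h)) / ‖h‖ ^ α / ‖h‖ ^ d

/-- The volume of the Euclidean unit ball. -/
noncomputable def ballVol (d : ℕ) : ℝ :=
  (volume : Measure (EuclideanSpace ℝ (Fin d))).real (Metric.ball 0 1)

lemma ballVol_nonneg (d : ℕ) : 0 ≤ ballVol d := measureReal_nonneg

/-! ### Radial integrals over annuli. -/

section Annulus

variable {d : ℕ}

/-- The closed annulus with radii `a` and `b`. -/
def annulus (d : ℕ) (a b : ℝ) : Set (EuclideanSpace ℝ (Fin d)) := {h | a ≤ ‖h‖ ∧ ‖h‖ ≤ b}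

lemma isCompact_annulus (a b : ℝ) : IsCompact (annulus d a b) := by
  refine Metric.isCompact_of_isClosed_isBounded ?_ ?_
  · exact (isClosed_le continuous_const continuous_norm).inter
      (isClosed_le continuous_norm continuous_const)
  · exact (Metric.isBounded_closedBall (x := (0 : EuclideanSpace ℝ (Fin d))) (r := b)).subset
      fun h hh => by simpa using hh.2

lemma measurableSet_annulus (a b : ℝ) : MeasurableSet (annulus d a b) :=
  (isCompact_annulus a b).measurableSet

lemma integrableOn_rpow_annulus (p : ℝ) {a b : ℝ} (ha : 0 < a) :
    IntegrableOn (fun h : EuclideanSpace ℝ (Fin d) => ‖h‖ ^ p / ‖h‖ ^ d) (annulus d a b) := by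
  refine ContinuousOn.integrableOn_compact (isCompact_annulus a b) ?_
  have h0 : ∀ h ∈ annulus d a b, ‖h‖ ≠ 0 := fun h hh => (ha.trans_le hh.1).ne'
  exact ContinuousOn.div (continuousOn_id.norm.rpow_const fun h hh => Or.inl (h0 h hh))
    (continuousOn_id.norm.pow d) fun h hh => pow_ne_zero _ (h0 h hh)

/-- Polar coordinates: the Jacobian `r ^ (d - 1)` against `r ^ (p - d)` leaves `r ^ (p - 1)`, and `p
≠ 0` excludes the logarithm. -/
lemma integral_rpow_annulus (hd : 1 ≤ d) {p : ℝ} (hp : p ≠ 0) {a b : ℝ} (ha : 0 < a)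
    (hab : a ≤ b) :
    ∫ h in annulus d a b, ‖h‖ ^ p / ‖h‖ ^ d = d * ballVol d * ((b ^ p - a ^ p) / p) := by
  have : Nonempty (Fin d) := ⟨⟨0, hd⟩⟩
  rw [← integral_indicator (measurableSet_annulus a b)]
  have h1 : (annulus d a b).indicator (fun h : EuclideanSpace ℝ (Fin d) => ‖h‖ ^ p / ‖h‖ ^ d) =
      fun h => (Set.Icc a b).indicator (fun r : ℝ => r ^ p / r ^ d) ‖h‖ := by
    ext h
    simp only [Set.indicator, annulus, Set.mem_ofPred_eq, Set.mem_Icc]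
    congr
  rw [h1, integral_fun_norm_addHaar volume
    (fun r => (Set.Icc a b).indicator (fun r : ℝ => r ^ p / r ^ d) r)]
  have h2 : ∫ y in Set.Ioi (0 : ℝ), y ^ (Module.finrank ℝ (EuclideanSpace ℝ (Fin d)) - 1) •
      (Set.Icc a b).indicator (fun r : ℝ => r ^ p / r ^ d) y = ∫ y in a..b, y ^ (p - 1) := by
    rw [intervalIntegral.integral_of_le hab, ← integral_Icc_eq_integral_Ioc,
      ← integral_indicator measurableSet_Icc, ← integral_indicator measurableSet_Ioi]
    congr 1
    ext y
    simp only [Set.indicator, Set.mem_Ioi, Set.mem_Icc, finrank_euclideanSpace, Fintype.card_fin]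
    by_cases hy : a ≤ y ∧ y ≤ b
    · have hy0 : 0 < y := ha.trans_le hy.1
      obtain ⟨k, rfl⟩ : ∃ k, d = k + 1 := ⟨d - 1, by omega⟩
      rw [if_pos hy0, if_pos hy, if_pos hy, Real.rpow_sub_one hy0.ne']
      simp only [Nat.add_sub_cancel, smul_eq_mul]
      field_simp
      rw [pow_succ]
    · rw [if_neg hy, if_neg hy]; simp
  rw [h2, integral_rpow]
  · simp [ballVol, mul_assoc]
  · right
    refine ⟨by simpa [sub_eq_iff_eq_add] using hp, ?_⟩
    rw [Set.uIcc_of_le hab]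
    exact fun h => absurd h.1 (not_le.2 ha)

/-- Integrals of `‖h‖ ^ (-α - d)` are governed by the inner radius. -/
lemma setIntegral_rpow_neg_le (hd : 1 ≤ d) {α : ℝ} (hα : 0 < α) {a b : ℝ} (ha : 0 < a)
    (hab : a ≤ b) {S : Set (EuclideanSpace ℝ (Fin d))} (hS : S ⊆ annulus d a b) :
    ∫ h in S, ‖h‖ ^ (-α) / ‖h‖ ^ d ≤ d * ballVol d * (a ^ (-α) / α) := by
  refine (setIntegral_mono_set (integrableOn_rpow_annulus _ ha)
    (ae_of_all _ fun h => by positivity) hS.eventuallyLE).trans ?_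
  rw [integral_rpow_annulus hd (by linarith) ha hab]
  have := ballVol_nonneg d
  refine mul_le_mul_of_nonneg_left ?_ (by positivity)
  rw [div_neg, ← neg_div]
  gcongr
  have : 0 ≤ b ^ (-α) := Real.rpow_nonneg (ha.le.trans hab) _
  linarith

/-- Integrals of `‖h‖ ^ (p - d)` with `p > 0` are governed by the outer radius. -/
lemma setIntegral_rpow_pos_le (hd : 1 ≤ d) {p : ℝ} (hp : 0 < p) {a b : ℝ} (ha : 0 < a)
    (hab : a ≤ b) {S : Set (EuclideanSpace ℝ (Fin d))} (hS : S ⊆ annulus d a b) :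
    ∫ h in S, ‖h‖ ^ p / ‖h‖ ^ d ≤ d * ballVol d * (b ^ p / p) := by
  refine (setIntegral_mono_set (integrableOn_rpow_annulus _ ha)
    (ae_of_all _ fun h => by positivity) hS.eventuallyLE).trans ?_
  rw [integral_rpow_annulus hd hp.ne' ha hab]
  have := ballVol_nonneg d
  refine mul_le_mul_of_nonneg_left ?_ (by positivity)
  gcongr
  have : 0 ≤ a ^ p := Real.rpow_nonneg ha.le _
  linarith

end Annulus

/-! ### Size, oscillation and cancellation of odd integrals. -/

section OddInt

variable {d : ℕ} {α : ℝ} {f : EuclideanSpace ℝ (Fin d) → ℝ}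

lemma continuous_of_holder (hα : 0 < α) (hf : ∀ x y, |f x - f y| ≤ ‖x - y‖ ^ α) :
    Continuous f := by
  rw [continuous_iff_continuousAt]
  intro x
  rw [ContinuousAt, tendsto_iff_norm_sub_tendsto_zero]
  refine squeeze_zero (fun _ => norm_nonneg _) (fun y => hf y x) ?_
  have : Continuous fun y : EuclideanSpace ℝ (Fin d) => ‖y - x‖ ^ α :=
    (continuous_id.sub continuous_const).norm.rpow_const fun _ => Or.inr hα.le
  simpa [Real.zero_rpow hα.ne'] using this.tendsto x

lemma abs_odd_difference_le (hα1 : α < 1)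
    (hf : ∀ x y, |f x - f y| ≤ ‖x - y‖ ^ α) (x h : EuclideanSpace ℝ (Fin d)) :
    |f (x + h) - f (x - h)| ≤ 2 * ‖h‖ ^ α := by
  refine (hf _ _).trans ?_
  have : x + h - (x - h) = (2 : ℝ) • h := by rw [two_smul]; abel
  rw [this, norm_smul, Real.norm_ofNat, Real.mul_rpow (by norm_num) (norm_nonneg _)]
  gcongr
  calc (2 : ℝ) ^ α ≤ 2 ^ (1 : ℝ) := Real.rpow_le_rpow_of_exponent_le (by norm_num) hα1.le
    _ = 2 := Real.rpow_one 2

lemma abs_integrand_le (hα1 : α < 1)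
    (hf : ∀ x y, |f x - f y| ≤ ‖x - y‖ ^ α) {a : ℝ} (ha : 0 < a)
    (x : EuclideanSpace ℝ (Fin d)) {h : EuclideanSpace ℝ (Fin d)} (hh : a ≤ ‖h‖) :
    |(f (x + h) - f (x - h)) / ‖h‖ ^ α / ‖h‖ ^ d| ≤ 2 / a ^ d := by
  have h0 : 0 < ‖h‖ := ha.trans_le hh
  have h1 : 0 < ‖h‖ ^ α := Real.rpow_pos_of_pos h0 _
  rw [abs_div, abs_div, abs_of_pos h1, abs_of_pos (pow_pos h0 d)]
  gcongr
  rw [div_le_iff₀ h1]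
  exact abs_odd_difference_le hα1 hf x h

lemma measurable_integrand (hα0 : 0 < α) (hf : ∀ x y, |f x - f y| ≤ ‖x - y‖ ^ α) :
    Measurable (fun z : EuclideanSpace ℝ (Fin d) × EuclideanSpace ℝ (Fin d) =>
      (f (z.1 + z.2) - f (z.1 - z.2)) / ‖z.2‖ ^ α / ‖z.2‖ ^ d) := by
  have hc := continuous_of_holder hα0 hf
  have h1 : Measurable fun z : EuclideanSpace ℝ (Fin d) × EuclideanSpace ℝ (Fin d) =>
      f (z.1 + z.2) := (hc.comp (continuous_fst.add continuous_snd)).measurable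
  have h2 : Measurable fun z : EuclideanSpace ℝ (Fin d) × EuclideanSpace ℝ (Fin d) =>
      f (z.1 - z.2) := (hc.comp (continuous_fst.sub continuous_snd)).measurable
  have h3 : Measurable fun z : EuclideanSpace ℝ (Fin d) × EuclideanSpace ℝ (Fin d) => ‖z.2‖ :=
    measurable_snd.norm
  exact ((h1.sub h2).div (h3.pow_const α)).div (h3.pow_const d)

lemma measure_annulus_ne_top (a b : ℝ) : volume (annulus d a b) ≠ ⊤ :=
  (isCompact_annulus a b).measure_lt_top.ne

lemma integrableOn_integrand (hα0 : 0 < α) (hα1 : α < 1)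
    (hf : ∀ x y, |f x - f y| ≤ ‖x - y‖ ^ α) {a b : ℝ} (ha : 0 < a)
    {S : Set (EuclideanSpace ℝ (Fin d))} (hSm : MeasurableSet S) (hS : S ⊆ annulus d a b)
    (x : EuclideanSpace ℝ (Fin d)) :
    IntegrableOn (fun h => (f (x + h) - f (x - h)) / ‖h‖ ^ α / ‖h‖ ^ d) S := by
  refine Measure.integrableOn_of_bounded (M := 2 / a ^ d) ?_ ?_ ?_
  · exact ((measure_mono hS).trans_lt (measure_annulus_ne_top a b).lt_top).ne
  · exact ((measurable_integrand hα0 hf).comp measurable_prodMk_left).aestronglyMeasurable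
  · filter_upwards [ae_restrict_mem hSm] with h hh
    exact abs_integrand_le hα1 hf ha x (hS hh).1

lemma measurable_oddInt (hα0 : 0 < α) (hf : ∀ x y, |f x - f y| ≤ ‖x - y‖ ^ α)
    (S : Set (EuclideanSpace ℝ (Fin d))) : Measurable (oddInt α S f) := by
  have := ((measurable_integrand hα0 hf).stronglyMeasurable).integral_prod_right'
    (ν := (volume : Measure (EuclideanSpace ℝ (Fin d))).restrict S)
  exact this.measurable

/-- The crude bound, effective when the radii of the annulus are comparable. -/
lemma abs_oddInt_le (hα1 : α < 1)
    (hf : ∀ x y, |f x - f y| ≤ ‖x - y‖ ^ α) {a b : ℝ} (ha : 0 < a) (hb : 0 ≤ b)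
    {S : Set (EuclideanSpace ℝ (Fin d))} (hS : S ⊆ annulus d a b)
    (x : EuclideanSpace ℝ (Fin d)) :
    |oddInt α S f x| ≤ 2 * (b / a) ^ d * ballVol d := by
  have hlt : volume S < ⊤ := (measure_mono hS).trans_lt (measure_annulus_ne_top a b).lt_top
  have h1 : |oddInt α S f x| ≤ 2 / a ^ d * volume.real S := by
    rw [oddInt, ← Real.norm_eq_abs]
    exact norm_setIntegral_le_of_norm_le_const hlt fun h hh =>
      abs_integrand_le hα1 hf ha x (hS hh).1
  have h2 : volume.real S ≤ b ^ d * ballVol d := by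
    have h3 : volume.real S ≤ volume.real (Metric.closedBall (0 : EuclideanSpace ℝ (Fin d)) b) :=
      measureReal_mono (fun h hh => by simpa using (hS hh).2)
        measure_closedBall_lt_top.ne
    rwa [Measure.addHaar_real_closedBall _ _ hb, finrank_euclideanSpace, Fintype.card_fin] at h3
  calc |oddInt α S f x| ≤ 2 / a ^ d * (b ^ d * ballVol d) := h1.trans (by gcongr)
    _ = _ := by rw [div_pow]; ring

/-- Each of the two values of `f` moves by at most `‖x - y‖ ^ α`, and the remaining weight has
integral of order `a ^ (-α)`. With `a` the side of a cube containing `x` and `y`, the oscillation is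
bounded. -/
lemma abs_oddInt_sub_le (hd : 1 ≤ d) (hα0 : 0 < α) (hα1 : α < 1)
    (hf : ∀ x y, |f x - f y| ≤ ‖x - y‖ ^ α) {a b : ℝ} (ha : 0 < a) (hab : a ≤ b)
    {S : Set (EuclideanSpace ℝ (Fin d))} (hSm : MeasurableSet S) (hS : S ⊆ annulus d a b)
    (x y : EuclideanSpace ℝ (Fin d)) :
    |oddInt α S f x - oddInt α S f y| ≤ 2 * (d * ballVol d / α) * (‖x - y‖ / a) ^ α := by
  unfold oddInt
  rw [← integral_sub (integrableOn_integrand hα0 hα1 hf ha hSm hS x)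
    (integrableOn_integrand hα0 hα1 hf ha hSm hS y)]
  have h1 : ∀ᵐ h ∂(volume.restrict S), ‖(f (x + h) - f (x - h)) / ‖h‖ ^ α / ‖h‖ ^ d -
      (f (y + h) - f (y - h)) / ‖h‖ ^ α / ‖h‖ ^ d‖ ≤
      2 * ‖x - y‖ ^ α * (‖h‖ ^ (-α) / ‖h‖ ^ d) := by
    filter_upwards [ae_restrict_mem hSm] with h hh
    have h0 : 0 < ‖h‖ := ha.trans_le (hS hh).1
    rw [← sub_div, ← sub_div, Real.norm_eq_abs, abs_div, abs_div,
      abs_of_pos (Real.rpow_pos_of_pos h0 α), abs_of_pos (pow_pos h0 d), Real.rpow_neg h0.le,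
      ← mul_div_assoc, ← div_eq_mul_inv]
    gcongr
    have e1 := hf (x + h) (y + h)
    have e2 := hf (x - h) (y - h)
    rw [add_sub_add_right_eq_sub] at e1
    rw [sub_sub_sub_cancel_right] at e2
    rw [abs_le] at *
    constructor <;> linarith
  refine (norm_integral_le_of_norm_le (((integrableOn_rpow_annulus (-α) ha).mono_set hS).const_mul
    (2 * ‖x - y‖ ^ α)) h1).trans ?_
  rw [integral_const_mul]
  have h2 := setIntegral_rpow_neg_le hd hα0 ha hab hS
  calc 2 * ‖x - y‖ ^ α * ∫ h in S, ‖h‖ ^ (-α) / ‖h‖ ^ d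
      ≤ 2 * ‖x - y‖ ^ α * (d * ballVol d * (a ^ (-α) / α)) := by gcongr
    _ = _ := by
      rw [Real.div_rpow (norm_nonneg _) ha.le, Real.rpow_neg ha.le]
      field_simp

lemma oddInt_diff (hα0 : 0 < α) (hα1 : α < 1)
    (hf : ∀ x y, |f x - f y| ≤ ‖x - y‖ ^ α) {a b : ℝ} (ha : 0 < a)
    {S T : Set (EuclideanSpace ℝ (Fin d))} (hSm : MeasurableSet S) (hTm : MeasurableSet T)
    (hS : S ⊆ annulus d a b) (hTS : T ⊆ S) (x : EuclideanSpace ℝ (Fin d)) :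
    oddInt α S f x - oddInt α T f x = oddInt α (S \ T) f x :=
  (setIntegral_sdiff hTm (integrableOn_integrand hα0 hα1 hf ha hSm hS x) hTS).symm

/-- Cancellation: if the mean of `f` over `Q` is Lipschitz under translations, then the odd
integral over small increments has a bounded integral over `Q`. -/
lemma abs_setIntegral_oddInt_le (hd : 1 ≤ d) (hα0 : 0 < α) (hα1 : α < 1)
    (hf : ∀ x y, |f x - f y| ≤ ‖x - y‖ ^ α) {a b : ℝ} (ha : 0 < a) (hab : a ≤ b)
    {S : Set (EuclideanSpace ℝ (Fin d))} (hSm : MeasurableSet S) (hS : S ⊆ annulus d a b)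
    {Q : Set (EuclideanSpace ℝ (Fin d))} (hQ : volume Q ≠ ⊤) {B : ℝ} (hB : 0 ≤ B)
    (h : ∀ v, ‖v‖ ≤ b → |∫ x in Q, (f (x + v) - f (x - v))| ≤ B * ‖v‖) :
    |∫ x in Q, oddInt α S f x| ≤ B * (d * ballVol d * (b ^ (1 - α) / (1 - α))) := by
  have hSfin : volume S ≠ ⊤ :=
    ((measure_mono hS).trans_lt (measure_annulus_ne_top a b).lt_top).ne
  have : IsFiniteMeasure (volume.restrict Q) := ⟨by simpa using hQ.lt_top⟩
  have : IsFiniteMeasure (volume.restrict S) := ⟨by simpa using hSfin.lt_top⟩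
  unfold oddInt
  -- Averaging in `x` before integrating in the increment is what exposes the cancellation.
  rw [integral_integral_swap]
  · have h1 : ∀ᵐ v ∂(volume.restrict S),
        ‖∫ x in Q, (f (x + v) - f (x - v)) / ‖v‖ ^ α / ‖v‖ ^ d‖ ≤
        B * (‖v‖ ^ (1 - α) / ‖v‖ ^ d) := by
      filter_upwards [ae_restrict_mem hSm] with v hv
      have h0 : 0 < ‖v‖ := ha.trans_le (hS hv).1
      rw [integral_div, integral_div, Real.norm_eq_abs, abs_div, abs_div,
        abs_of_pos (Real.rpow_pos_of_pos h0 α), abs_of_pos (pow_pos h0 d),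
        Real.rpow_sub h0, Real.rpow_one, ← mul_div_assoc, ← mul_div_assoc]
      gcongr
      exact h v (hS hv).2
    refine (norm_integral_le_of_norm_le
      (((integrableOn_rpow_annulus (1 - α) ha).mono_set hS).const_mul B) h1).trans ?_
    rw [integral_const_mul]
    exact mul_le_mul_of_nonneg_left (setIntegral_rpow_pos_le hd (by linarith) ha hab hS) hB
  · refine Integrable.of_bound (C := 2 / a ^ d) (measurable_integrand hα0 hf).aestronglyMeasurable ?_
    have h2 : ∀ᵐ v ∂(volume.restrict S), v ∈ S := ae_restrict_mem hSm
    filter_upwards [Measure.quasiMeasurePreserving_snd.ae h2] with z hz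
    exact abs_integrand_le hα1 hf ha z.1 (hS hz).1

end OddInt

/-! ### Boxes and the measure of their translates' differences. -/

section Box

variable {d : ℕ}

lemma volume_euclidean_box (J : Fin d → Set ℝ) :
    volume {x : EuclideanSpace ℝ (Fin d) | ∀ i, x i ∈ J i} = ∏ i, volume (J i) := by
  rw [← volume_pi_pi, ← (EuclideanSpace.volume_preserving_symm_measurableEquiv_toLp
    (Fin d)).measure_preimage_equiv]
  congr 1
  ext x
  simp [Set.mem_pi]

/-- The half-open box with corner `c` and side `l`. -/
def box (c : Fin d → ℝ) (l : ℝ) : Set (EuclideanSpace ℝ (Fin d)) :=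
  {x | ∀ i, x i ∈ Set.Ico (c i) (c i + l)}

lemma measurableSet_box (c : Fin d → ℝ) (l : ℝ) : MeasurableSet (box c l) := by
  have : box c l = ⋂ i, (fun x : EuclideanSpace ℝ (Fin d) => x i) ⁻¹' Set.Ico (c i) (c i + l) := by
    ext x; simp [box]
  rw [this]
  exact MeasurableSet.iInter fun i => measurableSet_Ico.preimage (by fun_prop)

lemma volume_box (c : Fin d → ℝ) (l : ℝ) : volume (box c l) = ENNReal.ofReal l ^ d := by
  unfold box
  rw [volume_euclidean_box]
  simp

lemma volume_real_box (c : Fin d → ℝ) {l : ℝ} (hl : 0 ≤ l) : volume.real (box c l) = l ^ d := by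
  rw [Measure.real, volume_box, ENNReal.toReal_pow, ENNReal.toReal_ofReal hl]

lemma norm_sub_le_of_mem_box {c : Fin d → ℝ} {l : ℝ} (hl : 0 ≤ l)
    {x y : EuclideanSpace ℝ (Fin d)} (hx : x ∈ box c l) (hy : y ∈ box c l) :
    ‖x - y‖ ≤ d * l := by
  rw [EuclideanSpace.norm_eq]
  have h1 : ∑ i, ‖(x - y) i‖ ^ 2 ≤ (d * l) ^ 2 := by
    calc ∑ i, ‖(x - y) i‖ ^ 2 ≤ ∑ _i : Fin d, l ^ 2 := by
          refine Finset.sum_le_sum fun i _ => ?_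
          have h2 := hx i
          have h3 := hy i
          simp only [Set.mem_Ico] at h2 h3
          rw [Real.norm_eq_abs, sq_abs, PiLp.sub_apply]
          exact sq_le_sq' (by linarith) (by linarith)
      _ = d * l ^ 2 := by simp
      _ ≤ (d * l) ^ 2 := by
          rw [mul_pow]
          gcongr
          exact_mod_cast Nat.le_self_pow two_ne_zero d
  calc _ ≤ √((d * l) ^ 2) := Real.sqrt_le_sqrt h1
    _ = d * l := Real.sqrt_sq (by positivity)

/-- A point leaving the original box does so in some coordinate `i`, which is then confined to an
interval of length `|v i|`: one of the two intervals, according to the sign of `v i`, and the other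
is empty. -/
lemma box_diff_subset (c v : Fin d → ℝ) (l : ℝ) :
    box (c + v) l \ box c l ⊆ ⋃ i, {x | ∀ j, x j ∈ (if j = i then
      Set.Ico (c i + l) (c i + l + v i) ∪ Set.Ico (c i + v i) (c i)
      else Set.Ico ((c + v) j) ((c + v) j + l))} := by
  rintro x ⟨hx, hx'⟩
  simp only [box, Set.mem_ofPred_eq, not_forall] at hx'
  obtain ⟨i, hi⟩ := hx'
  refine Set.mem_iUnion.2 ⟨i, fun j => ?_⟩
  have hj := hx j
  split_ifs with hji
  · subst hji
    simp only [Set.mem_Ico, not_and_or, not_le, not_lt, Pi.add_apply, Set.mem_union] at *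
    rcases hi with hi | hi
    · right; exact ⟨hj.1, hi⟩
    · left; exact ⟨hi, by linarith⟩
  · exact hj

lemma volume_real_box_diff_le (c v : Fin d → ℝ) {l : ℝ} (hl : 0 ≤ l) {r : ℝ}
    (hv : ∀ i, |v i| ≤ r) :
    volume.real (box (c + v) l \ box c l) ≤ d * (r * l ^ (d - 1)) := by
  -- With no coordinates `hv` is vacuous and does not give `0 ≤ r`.
  by_cases hd : d = 0
  · subst hd
    have : box (c + v) l \ box c l = ∅ := by
      ext x; simp [box]
    rw [this, measureReal_empty]
    simp
  have hr : 0 ≤ r := (abs_nonneg _).trans (hv ⟨0, Nat.pos_of_ne_zero hd⟩)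
  have key : volume (box (c + v) l \ box c l) ≤ ENNReal.ofReal (d * (r * l ^ (d - 1))) := by
    refine (measure_mono (box_diff_subset c v l)).trans ((measure_iUnion_fintype_le _ _).trans ?_)
    have h1 : ∀ i : Fin d, volume {x : EuclideanSpace ℝ (Fin d) | ∀ j, x j ∈ (if j = i then
        Set.Ico (c i + l) (c i + l + v i) ∪ Set.Ico (c i + v i) (c i)
        else Set.Ico ((c + v) j) ((c + v) j + l))} ≤ ENNReal.ofReal (r * l ^ (d - 1)) := by
      intro i
      rw [volume_euclidean_box, ← Finset.mul_prod_erase _ _ (Finset.mem_univ i), if_pos rfl,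
        ENNReal.ofReal_mul hr, ENNReal.ofReal_pow hl]
      refine mul_le_mul' ((measure_union_le _ _).trans ?_) (le_of_eq ?_)
      · rw [Real.volume_Ico, Real.volume_Ico]
        rcases le_total 0 (v i) with h | h
        · rw [ENNReal.ofReal_eq_zero.2 (by linarith : c i - (c i + v i) ≤ 0), add_zero]
          exact ENNReal.ofReal_le_ofReal (by linarith [le_abs_self (v i), hv i])
        · rw [ENNReal.ofReal_eq_zero.2 (by linarith : c i + l + v i - (c i + l) ≤ 0), zero_add]
          exact ENNReal.ofReal_le_ofReal (by linarith [neg_le_abs (v i), hv i])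
      · rw [Finset.prod_congr rfl (g := fun _ => ENNReal.ofReal l)]
        · simp
        · intro j hj
          rw [if_neg (Finset.ne_of_mem_erase hj), Real.volume_Ico, add_sub_cancel_left]
    refine (Finset.sum_le_sum fun i _ => h1 i).trans ?_
    rw [Finset.sum_const, Finset.card_univ, Fintype.card_fin, nsmul_eq_mul,
      ENNReal.ofReal_mul (Nat.cast_nonneg d), ENNReal.ofReal_natCast]
  exact ENNReal.toReal_le_of_le_ofReal (by positivity) key

end Box

/-! ### Means of a Hölder function over translated boxes. -/

section Translation

variable {d : ℕ} {α : ℝ} {f : EuclideanSpace ℝ (Fin d) → ℝ}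

lemma setIntegral_comp_add_box (g : EuclideanSpace ℝ (Fin d) → ℝ) (c : Fin d → ℝ) (l : ℝ)
    (v : EuclideanSpace ℝ (Fin d)) :
    ∫ x in box c l, g (x + v) = ∫ x in box (c + v.ofLp) l, g x := by
  have h1 : box c l = (fun x => x + v) ⁻¹' box (c + v.ofLp) l := by
    ext x
    simp only [box, Set.mem_ofPred_eq, Set.mem_preimage, Set.mem_Ico, Pi.add_apply,
      PiLp.add_apply]
    refine forall_congr' fun i => ?_
    constructor <;> rintro ⟨h, h'⟩ <;> constructor <;> linarith
  rw [h1]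
  exact (measurePreserving_add_right volume v).setIntegral_preimage_emb
    (measurableEmbedding_addRight v) g _

/-- The integral is a difference of integrals over two translates of the box, whose common part
cancels. The rest has measure of order `‖v‖ * l ^ (d - 1)`, and there `f` differs from its value at
the corner by at most `((d + 1) * l) ^ α`. -/
lemma abs_setIntegral_translate_le (hα0 : 0 < α)
    (hf : ∀ x y, |f x - f y| ≤ ‖x - y‖ ^ α) (c : Fin d → ℝ) {l : ℝ} (hl : 0 < l)
    {v : EuclideanSpace ℝ (Fin d)} (hv : ‖v‖ ≤ l) :
    |∫ x in box c l, (f (x + v) - f (x - v))| ≤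
      4 * d * (d + 1) ^ α * (l ^ (d - 1) * l ^ α) * ‖v‖ := by
  have hc := continuous_of_holder hα0 hf
  set x₀ : EuclideanSpace ℝ (Fin d) := WithLp.toLp 2 c with hx₀
  have hx₀m : x₀ ∈ box c l := fun i => ⟨le_rfl, by simpa [hx₀] using hl⟩
  -- Subtracting a constant leaves the odd difference unchanged and makes the integrand of size `l ^
  -- α`.
  set g : EuclideanSpace ℝ (Fin d) → ℝ := fun x => f x - f x₀ with hg
  have hgc : Continuous g := hc.sub continuous_const
  have hgb : ∀ w : EuclideanSpace ℝ (Fin d), ‖w‖ ≤ l → ∀ x ∈ box (c + w.ofLp) l,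
      ‖g x‖ ≤ ((d + 1) * l) ^ α := by
    intro w hw x hx
    refine (hf x x₀).trans (Real.rpow_le_rpow (norm_nonneg _) ?_ hα0.le)
    have h1 : x - w ∈ box c l := by
      intro i
      have := hx i
      simp only [Set.mem_Ico, Pi.add_apply, PiLp.sub_apply] at this ⊢
      constructor <;> linarith
    calc ‖x - x₀‖ = ‖(x - w - x₀) + w‖ := by congr 1; abel
      _ ≤ ‖x - w - x₀‖ + ‖w‖ := norm_add_le _ _
      _ ≤ d * l + l := add_le_add (norm_sub_le_of_mem_box hl.le h1 hx₀m) hw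
      _ = (d + 1) * l := by ring
  have hfin : ∀ c' : Fin d → ℝ, volume (box c' l) < ⊤ := fun c' => by
    rw [volume_box]; exact ENNReal.pow_lt_top ENNReal.ofReal_lt_top
  have hint : ∀ w : EuclideanSpace ℝ (Fin d), ‖w‖ ≤ l → IntegrableOn g (box (c + w.ofLp) l) := by
    intro w hw
    refine Measure.integrableOn_of_bounded (M := ((d + 1) * l) ^ α) (hfin _).ne
      hgc.aestronglyMeasurable ?_
    filter_upwards [ae_restrict_mem (measurableSet_box _ _)] with x hx using hgb w hw x hx
  have hint' : ∀ w : EuclideanSpace ℝ (Fin d), ‖w‖ ≤ l →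
      IntegrableOn (fun x => g (x + w)) (box c l) := by
    intro w hw
    have h1 : box c l = (fun x => x + w) ⁻¹' box (c + w.ofLp) l := by
      ext x
      simp only [box, Set.mem_ofPred_eq, Set.mem_preimage, Set.mem_Ico, Pi.add_apply,
        PiLp.add_apply]
      refine forall_congr' fun i => ?_
      constructor <;> rintro ⟨h, h'⟩ <;> constructor <;> linarith
    rw [h1]
    exact ((measurePreserving_add_right volume w).integrableOn_comp_preimage
      (measurableEmbedding_addRight w)).2 (hint w hw)
  have hv' : ‖-v‖ ≤ l := by rwa [norm_neg]
  have e1 : ∫ x in box c l, (f (x + v) - f (x - v)) =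
      (∫ x in box (c + v.ofLp) l, g x) - ∫ x in box (c + (-v).ofLp) l, g x := by
    rw [← setIntegral_comp_add_box, ← setIntegral_comp_add_box,
      ← integral_sub (hint' v hv) (hint' (-v) hv')]
    congr 1
    ext x
    simp only [hg, ← sub_eq_add_neg]
    ring
  set P := box (c + v.ofLp) l with hP
  set M := box (c + (-v).ofLp) l with hM
  have hPm : MeasurableSet P := measurableSet_box _ _
  have hMm : MeasurableSet M := measurableSet_box _ _
  have e2 : (∫ x in P, g x) - ∫ x in M, g x = (∫ x in P \ M, g x) - ∫ x in M \ P, g x := by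
    rw [← integral_inter_add_sdiff hMm (hint v hv), ← integral_inter_add_sdiff hPm (hint (-v) hv'),
      Set.inter_comm M P]
    ring
  have hcoord : ∀ i, |v i| ≤ ‖v‖ := fun i => PiLp.norm_apply_le v i
  -- The two boxes are displaced from each other by `2 v`.
  have m1 : volume.real (P \ M) ≤ d * (2 * ‖v‖ * l ^ (d - 1)) := by
    have h1 : c + v.ofLp = (c + (-v).ofLp) + (2 : ℝ) • v.ofLp := by
      ext i; simp; ring
    rw [hP, hM, h1]
    refine volume_real_box_diff_le _ _ hl.le fun i => ?_
    rw [Pi.smul_apply, smul_eq_mul, abs_mul, abs_two]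
    linarith [hcoord i]
  have m2 : volume.real (M \ P) ≤ d * (2 * ‖v‖ * l ^ (d - 1)) := by
    have h1 : c + (-v).ofLp = (c + v.ofLp) + (-2 : ℝ) • v.ofLp := by
      ext i; simp; ring
    rw [hP, hM, h1]
    refine volume_real_box_diff_le _ _ hl.le fun i => ?_
    rw [Pi.smul_apply, smul_eq_mul, abs_mul, abs_neg, abs_two]
    linarith [hcoord i]
  have i1 : |∫ x in P \ M, g x| ≤ ((d + 1) * l) ^ α * volume.real (P \ M) := by
    rw [← Real.norm_eq_abs]
    exact norm_setIntegral_le_of_norm_le_const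
      ((measure_mono Set.sdiff_subset).trans_lt (hfin _)) fun x hx => hgb v hv x hx.1
  have i2 : |∫ x in M \ P, g x| ≤ ((d + 1) * l) ^ α * volume.real (M \ P) := by
    rw [← Real.norm_eq_abs]
    exact norm_setIntegral_le_of_norm_le_const
      ((measure_mono Set.sdiff_subset).trans_lt (hfin _)) fun x hx => hgb (-v) hv' x hx.1
  rw [e1, e2]
  have hK : 0 ≤ (((d : ℝ) + 1) * l) ^ α := by positivity
  calc _ ≤ |∫ x in P \ M, g x| + |∫ x in M \ P, g x| := abs_sub _ _
    _ ≤ ((d + 1) * l) ^ α * (d * (2 * ‖v‖ * l ^ (d - 1))) +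
        ((d + 1) * l) ^ α * (d * (2 * ‖v‖ * l ^ (d - 1))) := by
      exact add_le_add (i1.trans (mul_le_mul_of_nonneg_left m1 hK))
        (i2.trans (mul_le_mul_of_nonneg_left m2 hK))
    _ = _ := by
      rw [Real.mul_rpow (by positivity) hl.le]
      ring

end Translation

/-! ### Exponential and maximal inequalities for martingales with bounded increments. -/

section MartingaleBounds

variable {Ω : Type*} {m0 : MeasurableSpace Ω} {μ : Measure Ω} [IsProbabilityMeasure μ]
  {ℱ : Filtration ℕ m0} {M : ℕ → Ω → ℝ} {R K : ℝ} {N : ℕ}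

lemma integrable_exp_of_bounded {X : Ω → ℝ} (hX : AEStronglyMeasurable X μ)
    (hR : ∀ᵐ ω ∂μ, |X ω| ≤ R) (t : ℝ) : Integrable (fun ω => Real.exp (t * X ω)) μ := by
  refine Integrable.of_bound (C := Real.exp (|t| * R))
    (Real.continuous_exp.comp_aestronglyMeasurable (hX.const_mul t)) ?_
  filter_upwards [hR] with ω hω
  rw [Real.norm_eq_abs, Real.abs_exp, Real.exp_le_exp]
  calc t * X ω ≤ |t * X ω| := le_abs_self _
    _ = |t| * |X ω| := abs_mul _ _
    _ ≤ |t| * R := by gcongr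

/-- The Azuma–Hoeffding induction: each step costs a factor `cosh (t * K) ≤ exp ((t * K) ^ 2 / 2)`.
The bound `R` only secures integrability and does not enter the estimate. -/
lemma MeasureTheory.Martingale.integral_exp_le (hM : Martingale M ℱ μ) (hK : 0 < K)
    (hR : ∀ n, ∀ᵐ ω ∂μ, |M n ω| ≤ R) (h0 : ∀ᵐ ω ∂μ, |M 0 ω| ≤ K)
    (hinc : ∀ n < N, ∀ᵐ ω ∂μ, |M (n + 1) ω - M n ω| ≤ K) (t : ℝ) (n : ℕ) (hn : n ≤ N) :
    ∫ ω, Real.exp (t * M n ω) ∂μ ≤ Real.exp (|t| * K + n * ((t * K) ^ 2 / 2)) := by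
  have hint : ∀ n, Integrable (fun ω => Real.exp (t * M n ω)) μ := fun n =>
    integrable_exp_of_bounded (hM.integrable n).aestronglyMeasurable (hR n) t
  induction n with
  | zero =>
    calc ∫ ω, Real.exp (t * M 0 ω) ∂μ ≤ ∫ _ω, Real.exp (|t| * K) ∂μ := by
          refine integral_mono_ae (hint 0) (integrable_const _) ?_
          filter_upwards [h0] with ω hω
          refine Real.exp_le_exp.2 ?_
          calc t * M 0 ω ≤ |t * M 0 ω| := le_abs_self _
            _ = |t| * |M 0 ω| := abs_mul _ _
            _ ≤ |t| * K := by gcongr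
      _ = _ := by simp
  | succ n ih =>
    have ih' := ih (by omega)
    set g : Ω → ℝ := fun ω => Real.exp (t * M n ω) with hg
    set D : Ω → ℝ := M (n + 1) - M n with hD
    have hgm : StronglyMeasurable[ℱ n] g :=
      Real.continuous_exp.comp_stronglyMeasurable ((hM.stronglyMeasurable n).const_mul t)
    have hDint : Integrable D μ := (hM.integrable _).sub (hM.integrable _)
    have hgD : Integrable (g * D) μ := by
      refine (hint n).mul_bdd (c := K) hDint.aestronglyMeasurable ?_
      filter_upwards [hinc n (by omega)] with ω hω using hω
    -- A martingale difference is orthogonal to functions of the past.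
    have hzero : ∫ ω, (g * D) ω ∂μ = 0 := by
      rw [← integral_condExp (ℱ.le n)]
      have h1 := condExp_mul_of_stronglyMeasurable_left hgm hgD hDint
      have h2 : μ[D | ℱ n] =ᵐ[μ] 0 := by
        refine (condExp_sub (hM.integrable _) (hM.integrable _) _).trans ?_
        filter_upwards [hM.condExp_ae_eq (Nat.le_succ n), hM.condExp_ae_eq (le_refl n)]
          with ω h3 h4
        rw [Pi.sub_apply, Nat.succ_eq_add_one] at *
        simp [h3, h4]
      rw [integral_congr_ae (g := fun _ => (0 : ℝ)) ?_, integral_zero]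
      filter_upwards [h1, h2] with ω h3 h4
      rw [h3, Pi.mul_apply, h4, Pi.zero_apply, mul_zero]
    have hpt : ∀ᵐ ω ∂μ, Real.exp (t * M (n + 1) ω) ≤
        Real.cosh (t * K) * g ω + Real.sinh (t * K) / K * (g * D) ω := by
      -- Convexity: on `[-K, K]` the exponential lies below its chord.
      filter_upwards [hinc n (by omega)] with ω hω
      have h1 : Real.exp (t * (M (n + 1) ω - M n ω)) ≤ Real.cosh (t * K) +
          (M (n + 1) ω - M n ω) / K * Real.sinh (t * K) := by
        have h2 := Real.exp_mul_le_cosh_add_mul_sinh (t := (M (n + 1) ω - M n ω) / K)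
          (by rwa [abs_div, abs_of_pos hK, div_le_one hK]) (t * K)
        rwa [show (M (n + 1) ω - M n ω) / K * (t * K) = t * (M (n + 1) ω - M n ω) by
          field_simp] at h2
      calc Real.exp (t * M (n + 1) ω) = g ω * Real.exp (t * (M (n + 1) ω - M n ω)) := by
            rw [hg, ← Real.exp_add]; ring_nf
        _ ≤ g ω * _ := mul_le_mul_of_nonneg_left h1 (Real.exp_pos _).le
        _ = _ := by
          rw [Pi.mul_apply, hD, Pi.sub_apply]; ring
    calc ∫ ω, Real.exp (t * M (n + 1) ω) ∂μ
        ≤ ∫ ω, (Real.cosh (t * K) * g ω + Real.sinh (t * K) / K * (g * D) ω) ∂μ :=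
          integral_mono_ae (hint _) (((hint n).const_mul _).add (hgD.const_mul _)) hpt
      _ = Real.cosh (t * K) * ∫ ω, g ω ∂μ := by
          rw [integral_add ((hint n).const_mul _) (hgD.const_mul _), integral_const_mul,
            integral_const_mul, hzero, mul_zero, add_zero]
      _ ≤ Real.exp ((t * K) ^ 2 / 2) * Real.exp (|t| * K + n * ((t * K) ^ 2 / 2)) :=
          mul_le_mul (Real.cosh_le_exp_half_sq _) ih'
            (integral_nonneg fun _ => (Real.exp_pos _).le) (Real.exp_pos _).le
      _ = _ := by
          rw [← Real.exp_add]; push_cast; ring_nf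

lemma MeasureTheory.Martingale.submartingale_exp (hM : Martingale M ℱ μ)
    (hR : ∀ n, ∀ᵐ ω ∂μ, |M n ω| ≤ R) (t : ℝ) :
    Submartingale (fun n ω => Real.exp (t * M n ω)) ℱ μ := by
  have hint : ∀ n, Integrable (fun ω => Real.exp (t * M n ω)) μ := fun n =>
    integrable_exp_of_bounded (hM.integrable n).aestronglyMeasurable (hR n) t
  refine ⟨fun n => Real.continuous_exp.comp_stronglyMeasurable
    ((hM.stronglyMeasurable n).const_mul t), fun i j hij => ?_, hint⟩
  have hconv : ConvexOn ℝ Set.univ fun x : ℝ => Real.exp (t * x) := by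
    exact convexOn_exp.comp_linearMap (LinearMap.mul ℝ ℝ t)
  have h1 := hconv.map_condExp_le (μ := μ) (f := M j) (ℱ.le i)
    ((Continuous.lowerSemicontinuous (by fun_prop)).lowerSemicontinuousOn _) (by simp) isClosed_univ
    (hM.integrable j) (hint j)
  filter_upwards [h1, hM.condExp_ae_eq hij] with ω h2 h3
  rw [Function.comp_apply, h3] at h2
  exact h2

/-- Doob's maximal inequality for the exponential submartingale; `t` is left free for optimisation.
-/
lemma MeasureTheory.Martingale.measure_exists_ge_le (hM : Martingale M ℱ μ) (hK : 0 < K)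
    (hR : ∀ n, ∀ᵐ ω ∂μ, |M n ω| ≤ R) (h0 : ∀ᵐ ω ∂μ, |M 0 ω| ≤ K)
    (hinc : ∀ n < N, ∀ᵐ ω ∂μ, |M (n + 1) ω - M n ω| ≤ K) {t : ℝ} (ht : 0 ≤ t) (a : ℝ) :
    μ {ω | ∃ n ≤ N, a ≤ M n ω} ≤
      ENNReal.ofReal (Real.exp (-(t * a) + t * K + N * ((t * K) ^ 2 / 2))) := by
  have hsub := hM.submartingale_exp hR t
  have h1 := maximal_ineq hsub (fun n ω => (Real.exp_pos _).le)
    (ε := (Real.exp (t * a)).toNNReal) N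
  rw [Real.coe_toNNReal _ (Real.exp_pos _).le] at h1
  set s : Set Ω := {ω | Real.exp (t * a) ≤ (Finset.range (N + 1)).sup'
    Finset.nonempty_range_add_one fun k => Real.exp (t * M k ω)} with hs
  have hsubset : {ω | ∃ n ≤ N, a ≤ M n ω} ⊆ s := by
    rintro ω ⟨n, hn, han⟩
    refine (Real.exp_le_exp.2 (mul_le_mul_of_nonneg_left han ht)).trans ?_
    exact Finset.le_sup' (fun k => Real.exp (t * M k ω)) (Finset.mem_range.2 (by omega))
  have h2 : ENNReal.ofReal (Real.exp (t * a)) * μ s ≤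
      ENNReal.ofReal (Real.exp (t * K + N * ((t * K) ^ 2 / 2))) := by
    refine h1.trans (ENNReal.ofReal_le_ofReal ?_)
    refine (setIntegral_le_integral (hsub.integrable N)
      (ae_of_all _ fun _ => (Real.exp_pos _).le)).trans ?_
    have := hM.integral_exp_le hK hR h0 hinc t N le_rfl
    rwa [abs_of_nonneg ht] at this
  refine (measure_mono hsubset).trans ?_
  have hpos : ENNReal.ofReal (Real.exp (t * a)) ≠ 0 := by
    simpa using Real.exp_pos _
  rw [show -(t * a) + t * K + N * ((t * K) ^ 2 / 2) =
    (t * K + N * ((t * K) ^ 2 / 2)) - t * a by ring, Real.exp_sub,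
    ENNReal.ofReal_div_of_pos (Real.exp_pos _),
    ENNReal.le_div_iff_mul_le (Or.inl hpos) (Or.inl ENNReal.ofReal_ne_top), mul_comm]
  exact h2

lemma MeasureTheory.Martingale.measure_exists_abs_ge_le (hM : Martingale M ℱ μ) (hK : 0 < K)
    (hR : ∀ n, ∀ᵐ ω ∂μ, |M n ω| ≤ R) (h0 : ∀ᵐ ω ∂μ, |M 0 ω| ≤ K)
    (hinc : ∀ n < N, ∀ᵐ ω ∂μ, |M (n + 1) ω - M n ω| ≤ K) {t : ℝ} (ht : 0 ≤ t) (a : ℝ) :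
    μ {ω | ∃ n ≤ N, a ≤ |M n ω|} ≤
      2 * ENNReal.ofReal (Real.exp (-(t * a) + t * K + N * ((t * K) ^ 2 / 2))) := by
  have h1 := hM.measure_exists_ge_le hK hR h0 hinc ht a
  have h2 := hM.neg.measure_exists_ge_le (N := N) hK (R := R)
    (fun n => by simpa using hR n) (by simpa using h0)
    (fun n hn => by
      filter_upwards [hinc n hn] with ω hω
      rw [← abs_neg]
      simpa [sub_eq_add_neg, add_comm] using hω) ht a
  rw [two_mul]
  refine (measure_mono ?_).trans ((measure_union_le _ _).trans (add_le_add h1 h2))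
  rintro ω ⟨n, hn, han⟩
  rcases le_abs.1 han with h | h
  · exact Or.inl ⟨n, hn, h⟩
  · exact Or.inr ⟨n, hn, by simpa using h⟩

lemma Real.sq_le_two_mul_exp_add_exp_neg (x : ℝ) :
    x ^ 2 ≤ 2 * (Real.exp x + Real.exp (-x)) := by
  have h1 := Real.quadratic_le_exp_of_nonneg (abs_nonneg x)
  rw [sq_abs] at h1
  have h2 : Real.exp |x| ≤ Real.exp x + Real.exp (-x) := by
    rcases abs_cases x with ⟨h, _⟩ | ⟨h, _⟩ <;> rw [h]
    · linarith [Real.exp_pos (-x)]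
    · linarith [Real.exp_pos x]
  linarith [abs_nonneg x]

/-- The exponential moments at `t = ± 1 / √N` stay bounded in `N`, and they control `(t * M N) ^ 2 =
M N ^ 2 / N`; no orthogonality expansion is needed. -/
lemma MeasureTheory.Martingale.integral_sq_le (hM : Martingale M ℱ μ) (hK : 0 < K)
    (hR : ∀ n, ∀ᵐ ω ∂μ, |M n ω| ≤ R) (h0 : ∀ᵐ ω ∂μ, |M 0 ω| ≤ K)
    (hinc : ∀ n < N, ∀ᵐ ω ∂μ, |M (n + 1) ω - M n ω| ≤ K) (hN : 1 ≤ N) :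
    ∫ ω, M N ω ^ 2 ∂μ ≤ 4 * N * Real.exp (K + K ^ 2 / 2) := by
  have hN0 : (0 : ℝ) < N := by exact_mod_cast hN
  set t : ℝ := 1 / √N with ht
  have hsq : 0 < √(N : ℝ) := Real.sqrt_pos.2 hN0
  have ht0 : 0 < t := by positivity
  have ht1 : t ≤ 1 := by
    rw [ht, div_le_one hsq]
    exact Real.one_le_sqrt.2 (by exact_mod_cast hN)
  have ht2 : (N : ℝ) * t ^ 2 = 1 := by
    rw [ht, div_pow, Real.sq_sqrt hN0.le]; field_simp
  have hint : ∀ s : ℝ, Integrable (fun ω => Real.exp (s * M N ω)) μ := fun s =>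
    integrable_exp_of_bounded (hM.integrable N).aestronglyMeasurable (hR N) s
  have hE : ∀ s : ℝ, |s| = t → ∫ ω, Real.exp (s * M N ω) ∂μ ≤ Real.exp (K + K ^ 2 / 2) := by
    intro s hs
    refine (hM.integral_exp_le hK hR h0 hinc s N le_rfl).trans (Real.exp_le_exp.2 ?_)
    rw [hs, mul_pow, ← sq_abs s, hs]
    have : (N : ℝ) * (t ^ 2 * K ^ 2 / 2) = K ^ 2 / 2 := by
      rw [show (N : ℝ) * (t ^ 2 * K ^ 2 / 2) = (N * t ^ 2) * (K ^ 2 / 2) by ring, ht2, one_mul]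
    rw [this]
    have : t * K ≤ 1 * K := by gcongr
    linarith
  have hpt : ∀ ω, M N ω ^ 2 ≤ N * (2 * (Real.exp (t * M N ω) + Real.exp (-t * M N ω))) := by
    intro ω
    have h1 := Real.sq_le_two_mul_exp_add_exp_neg (t * M N ω)
    calc M N ω ^ 2 = N * (t * M N ω) ^ 2 := by rw [mul_pow, ← mul_assoc, ht2, one_mul]
      _ ≤ _ := by rw [neg_mul]; gcongr
  have hsum : Integrable (fun ω => N * (2 * (Real.exp (t * M N ω) + Real.exp (-t * M N ω)))) μ :=
    (((hint t).add (hint (-t))).const_mul 2).const_mul _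
  calc ∫ ω, M N ω ^ 2 ∂μ
      ≤ ∫ ω, N * (2 * (Real.exp (t * M N ω) + Real.exp (-t * M N ω))) ∂μ :=
        integral_mono_of_nonneg (ae_of_all _ fun _ => sq_nonneg _) hsum (ae_of_all _ hpt)
    _ = N * (2 * (∫ ω, Real.exp (t * M N ω) ∂μ + ∫ ω, Real.exp (-t * M N ω) ∂μ)) := by
        rw [integral_const_mul, integral_const_mul, integral_add (hint t) (hint (-t))]
    _ ≤ N * (2 * (Real.exp (K + K ^ 2 / 2) + Real.exp (K + K ^ 2 / 2))) := by
        gcongr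
        · exact hE t (abs_of_pos ht0)
        · exact hE (-t) (by rw [abs_neg, abs_of_pos ht0])
    _ = _ := by ring

end MartingaleBounds

/-! ### Mean square and iterated logarithm for approximate martingales. -/

section ApproximateMartingale

variable {Ω : Type*} {m0 : MeasurableSpace Ω} {μ : Measure Ω}
  {ℱ : Filtration ℕ m0} {F : ℕ → Ω → ℝ} {C : ℝ}

/-- A sequence of functions that stays within `C` of its own conditional expectations and has
increments at most `C`. -/
structure IsApproxMartingale (F : ℕ → Ω → ℝ) (ℱ : Filtration ℕ m0) (μ : Measure Ω) (C : ℝ) :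
    Prop where
  pos : 0 < C
  measurable : ∀ n, Measurable (F n)
  zero : ∀ᵐ ω ∂μ, |F 0 ω| ≤ C
  step : ∀ n, ∀ᵐ ω ∂μ, |F (n + 1) ω - F n ω| ≤ C
  condExp : ∀ N, ∀ n ≤ N, ∀ᵐ ω ∂μ, |μ[F N | ℱ n] ω - F n ω| ≤ C

namespace IsApproxMartingale

lemma bounded (h : IsApproxMartingale F ℱ μ C) (n : ℕ) : ∀ᵐ ω ∂μ, |F n ω| ≤ (n + 1) * C := by
  induction n with
  | zero => simpa using h.zero
  | succ n ih =>
    filter_upwards [ih, h.step n] with ω h1 h2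
    push_cast
    rw [abs_le] at *
    constructor <;> linarith

lemma condExp_bounded (h : IsApproxMartingale F ℱ μ C) (N n : ℕ) :
    ∀ᵐ ω ∂μ, |μ[F N | ℱ n] ω| ≤ (N + 1) * C := by
  exact ae_bdd_abs_condExp_of_ae_bdd_abs (h.bounded N)

lemma condExp_zero (h : IsApproxMartingale F ℱ μ C) (N : ℕ) :
    ∀ᵐ ω ∂μ, |μ[F N | ℱ 0] ω| ≤ 3 * C := by
  have hC := h.pos
  filter_upwards [h.condExp N 0 (Nat.zero_le _), h.zero] with ω h1 h2
  rw [abs_le] at *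
  constructor <;> linarith

/-- Two comparison errors and one increment of `F` account for the factor `3`. -/
lemma condExp_step (h : IsApproxMartingale F ℱ μ C) (N n : ℕ) (hn : n < N) :
    ∀ᵐ ω ∂μ, |μ[F N | ℱ (n + 1)] ω - μ[F N | ℱ n] ω| ≤ 3 * C := by
  filter_upwards [h.condExp N n hn.le, h.condExp N (n + 1) hn, h.step n] with ω h1 h2 h3
  rw [abs_le] at *
  constructor <;> linarith

lemma integral_sq_le [IsProbabilityMeasure μ] (h : IsApproxMartingale F ℱ μ C) {N : ℕ} (hN : 1 ≤ N) :
    ∫ ω, F N ω ^ 2 ∂μ ≤ (8 * Real.exp (3 * C + (3 * C) ^ 2 / 2) + 2 * C ^ 2) * N := by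
  have hC := h.pos
  have h1 := (martingale_condExp (F N) ℱ μ).integral_sq_le (by positivity : 0 < 3 * C)
    (h.condExp_bounded N) (h.condExp_zero N) (h.condExp_step N) hN
  have hint : Integrable (fun ω => (μ[F N | ℱ N] ω) ^ 2) μ := by
    refine Integrable.of_bound (C := ((N + 1) * C) ^ 2)
      ((integrable_condExp).aestronglyMeasurable.pow 2) ?_
    filter_upwards [h.condExp_bounded N N] with ω hω
    rw [norm_pow, Real.norm_eq_abs]
    gcongr
  have hpt : ∀ᵐ ω ∂μ, F N ω ^ 2 ≤ 2 * (μ[F N | ℱ N] ω) ^ 2 + 2 * C ^ 2 := by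
    filter_upwards [h.condExp N N le_rfl] with ω hω
    have h2 : (μ[F N | ℱ N] ω - F N ω) ^ 2 ≤ C ^ 2 := by
      rw [← sq_abs]; gcongr
    nlinarith [sq_nonneg (2 * μ[F N | ℱ N] ω - F N ω)]
  have hN1 : (1 : ℝ) ≤ N := by exact_mod_cast hN
  calc ∫ ω, F N ω ^ 2 ∂μ ≤ ∫ ω, (2 * (μ[F N | ℱ N] ω) ^ 2 + 2 * C ^ 2) ∂μ :=
        integral_mono_of_nonneg (ae_of_all _ fun _ => sq_nonneg _)
          ((hint.const_mul 2).add (integrable_const _)) hpt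
    _ = 2 * ∫ ω, (μ[F N | ℱ N] ω) ^ 2 ∂μ + 2 * C ^ 2 := by
        rw [integral_add (hint.const_mul 2) (integrable_const _), integral_const_mul]
        simp
    _ ≤ 2 * (4 * N * Real.exp (3 * C + (3 * C) ^ 2 / 2)) + 2 * C ^ 2 * N := by
        refine add_le_add (by gcongr) ?_
        exact le_mul_of_one_le_right (by positivity) hN1
    _ = _ := by ring

/-- The upper half of the law of the iterated logarithm, along dyadic blocks. -/
lemma ae_eventually_le [IsProbabilityMeasure μ] (h : IsApproxMartingale F ℱ μ C) :
    ∀ᵐ ω ∂μ, ∀ᶠ j : ℕ in atTop, ∀ n ≤ 2 ^ j,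
      |F n ω| ≤ ((3 * C) ^ 2 / 2 + 2 + C) * √(2 ^ j * Real.log j) := by
  have hC := h.pos
  set K := 3 * C with hKdef
  have hK : 0 < K := by positivity
  set A : ℝ := K ^ 2 / 2 + 2 with hA
  set s : ℕ → Set Ω := fun j =>
    {ω | ∃ n ≤ 2 ^ j, A * √(2 ^ j * Real.log j) ≤ |μ[F (2 ^ j) | ℱ n] ω|} with hs
  have hmeas : ∀ j : ℕ, 1 ≤ j →
      μ (s j) ≤ ENNReal.ofReal (2 * Real.exp K * (1 / (j : ℝ) ^ 2)) := by
    intro j hj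
    have hj0 : (0 : ℝ) < j := by exact_mod_cast hj
    have hL : 0 ≤ Real.log j := Real.log_nonneg (by exact_mod_cast hj)
    have hp : (0 : ℝ) < 2 ^ j := by positivity
    set t : ℝ := √(Real.log j) / √(2 ^ j) with ht
    have ht0 : 0 ≤ t := by positivity
    have ht2 : t ^ 2 = Real.log j / 2 ^ j := by
      rw [ht, div_pow, Real.sq_sqrt hL, Real.sq_sqrt hp.le]
    have ht1 : t ≤ 1 := by
      rw [← abs_of_nonneg ht0, ← sq_le_one_iff_abs_le_one, ht2, div_le_one hp]
      have h1 := Real.log_le_sub_one_of_pos hj0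
      have h2 : (j : ℝ) < 2 ^ j := by exact_mod_cast Nat.lt_two_pow_self
      linarith
    have hta : t * (A * √(2 ^ j * Real.log j)) = A * Real.log j := by
      rw [Real.sqrt_mul hp.le, ht]
      have := Real.mul_self_sqrt hL
      have h2 : √((2 : ℝ) ^ j) ≠ 0 := (Real.sqrt_pos.2 hp).ne'
      field_simp
      rw [pow_two, this, mul_comm]
    have h1 := (martingale_condExp (F (2 ^ j)) ℱ μ).measure_exists_abs_ge_le hK
      (h.condExp_bounded _) (h.condExp_zero _) (h.condExp_step (2 ^ j)) ht0
      (A * √(2 ^ j * Real.log j))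
    refine h1.trans ?_
    rw [← ENNReal.ofReal_ofNat, ← ENNReal.ofReal_mul (by norm_num), mul_assoc]
    refine ENNReal.ofReal_le_ofReal (mul_le_mul_of_nonneg_left ?_ (by norm_num))
    have h2 : (1 / (j : ℝ) ^ 2) = Real.exp (-(2 * Real.log j)) := by
      rw [Real.exp_neg, one_div, ← Real.exp_log (pow_pos hj0 2), Real.log_pow]
      norm_num
    rw [h2, ← Real.exp_add, Real.exp_le_exp, hta, mul_pow, ht2]
    have h3 : ((2 ^ j : ℕ) : ℝ) * (Real.log j / 2 ^ j * K ^ 2 / 2) = K ^ 2 / 2 * Real.log j := by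
      push_cast; field_simp
    rw [h3, hA]
    have : t * K ≤ 1 * K := by gcongr
    linarith
  have hsum : ∑' j, μ (s (j + 1)) ≠ ⊤ := by
    have h1 : Summable fun j : ℕ => 2 * Real.exp K * (1 / (((j + 1 : ℕ) : ℝ)) ^ 2) :=
      ((summable_nat_add_iff 1).2 (Real.summable_one_div_nat_pow.2 one_lt_two)).mul_left _
    refine ne_top_of_le_ne_top h1.tsum_ofReal_ne_top ?_
    exact ENNReal.tsum_le_tsum fun j => hmeas (j + 1) (by omega)
  have hBC := ae_eventually_notMem hsum
  have hcond : ∀ᵐ ω ∂μ, ∀ N, ∀ n, n ≤ N → |μ[F N | ℱ n] ω - F n ω| ≤ C := by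
    rw [ae_all_iff]; intro N
    rw [ae_all_iff]; intro n
    by_cases hn : n ≤ N
    · filter_upwards [h.condExp N n hn] with ω hω _ using hω
    · exact ae_of_all _ fun ω hn' => absurd hn' hn
  filter_upwards [hBC, hcond] with ω h1 h2
  have h3 : ∀ᶠ j in atTop, ω ∉ s j := by
    obtain ⟨j₀, hj₀⟩ := eventually_atTop.1 h1
    refine eventually_atTop.2 ⟨j₀ + 1, fun j hj => ?_⟩
    obtain ⟨k, rfl⟩ : ∃ k, j = k + 1 := ⟨j - 1, by omega⟩
    exact hj₀ k (by omega)
  -- From `j = 3` on `log j ≥ 1`, so the additive error `C` is absorbed by the square root.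
  filter_upwards [h3, eventually_ge_atTop 3] with j hj hj3 n hn
  have h4 : |μ[F (2 ^ j) | ℱ n] ω| < A * √(2 ^ j * Real.log j) := by
    by_contra hcon
    exact hj ⟨n, hn, not_lt.1 hcon⟩
  have h5 := h2 (2 ^ j) n hn
  have h6 : 1 ≤ √(2 ^ j * Real.log j) := by
    rw [Real.one_le_sqrt]
    have h7 : (1 : ℝ) ≤ Real.log j := by
      rw [Real.le_log_iff_exp_le (by positivity)]
      have : (3 : ℝ) ≤ j := by exact_mod_cast hj3
      linarith [Real.exp_one_lt_d9]
    have h8 : (1 : ℝ) ≤ 2 ^ j := one_le_pow₀ (by norm_num)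
    nlinarith
  have h9 : C ≤ C * √(2 ^ j * Real.log j) := le_mul_of_one_le_right hC.le h6
  rw [abs_lt] at h4
  rw [abs_le] at h5 ⊢
  constructor <;> linarith

end IsApproxMartingale

end ApproximateMartingale

/-! ### The dyadic filtration. -/

section Dyadic

variable {d : ℕ}

/-- The index of the dyadic cube of side `2 ^ (-n)` that contains `x`. -/
noncomputable def dyadicIndex (n : ℕ) (x : EuclideanSpace ℝ (Fin d)) : Fin d → ℤ :=
  fun i => ⌊2 ^ n * x i⌋

lemma measurable_dyadicIndex (n : ℕ) : Measurable (dyadicIndex (d := d) n) := by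
  refine measurable_pi_iff.2 fun i => Int.measurable_floor.comp ?_
  fun_prop

/-- Each index is a function of the next one, which makes the dyadic σ-algebras increase. -/
lemma dyadicIndex_eq_comp (n : ℕ) : dyadicIndex (d := d) n =
    (fun (k : Fin d → ℤ) i => k i / 2) ∘ dyadicIndex (n + 1) := by
  ext x i
  have h1 : (2 : ℝ) ^ n * x i = (2 ^ (n + 1) * x i) / (2 : ℕ) := by
    push_cast; rw [pow_succ]; ring
  simp only [dyadicIndex, Function.comp_apply]
  rw [h1, Int.floor_div_natCast]
  rfl

/-- The filtration of `ℝ^d` by dyadic cubes. -/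
noncomputable def dyadicFiltration (d : ℕ) :
    Filtration ℕ (inferInstance : MeasurableSpace (EuclideanSpace ℝ (Fin d))) where
  seq n := MeasurableSpace.comap (dyadicIndex n) inferInstance
  mono' := by
    refine monotone_nat_of_le_succ fun n => ?_
    rw [dyadicIndex_eq_comp n, ← MeasurableSpace.comap_comp]
    exact MeasurableSpace.comap_mono (measurable_of_countable _).comap_le
  le' n := (measurable_dyadicIndex n).comap_le

lemma mem_box_dyadicIndex_iff (n : ℕ) (x y : EuclideanSpace ℝ (Fin d)) :
    y ∈ box (fun i => (dyadicIndex n x i : ℝ) * ((2 : ℝ) ^ n)⁻¹) ((2 : ℝ) ^ n)⁻¹ ↔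
      dyadicIndex n y = dyadicIndex n x := by
  have hp : (0 : ℝ) < 2 ^ n := by positivity
  rw [funext_iff]
  refine forall_congr' fun i => ?_
  rw [dyadicIndex, Int.floor_eq_iff, Set.mem_Ico]
  beta_reduce
  rw [← div_eq_mul_inv, ← one_div, ← add_div,
    div_le_iff₀ hp, lt_div_iff₀ hp, mul_comm (y i)]

lemma measurableSet_dyadic_box (n : ℕ) (x : EuclideanSpace ℝ (Fin d)) :
    MeasurableSet[dyadicFiltration d n]
      (box (fun i => (dyadicIndex n x i : ℝ) * ((2 : ℝ) ^ n)⁻¹) ((2 : ℝ) ^ n)⁻¹) :=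
  ⟨{dyadicIndex n x}, measurableSet_singleton _, by
    ext y; rw [mem_box_dyadicIndex_iff]; rfl⟩

lemma dyadic_box_subset (n : ℕ) {x : EuclideanSpace ℝ (Fin d)} (hx : x ∈ box (0 : Fin d → ℝ) 1) :
    box (fun i => (dyadicIndex n x i : ℝ) * ((2 : ℝ) ^ n)⁻¹) ((2 : ℝ) ^ n)⁻¹ ⊆ box 0 1 := by
  intro y hy i
  have hp : (0 : ℝ) < 2 ^ n := by positivity
  have h1 := congrFun ((mem_box_dyadicIndex_iff n x y).1 hy) i
  have hxi := hx i
  simp only [Set.mem_Ico, Pi.zero_apply, zero_add] at hxi ⊢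
  have h2 : 0 ≤ ⌊2 ^ n * y i⌋ := by
    have : dyadicIndex n y i = ⌊2 ^ n * y i⌋ := rfl
    rw [← this, h1]
    exact Int.floor_nonneg.2 (mul_nonneg hp.le hxi.1)
  have h3 : ⌊2 ^ n * y i⌋ < 2 ^ n := by
    have : dyadicIndex n y i = ⌊2 ^ n * y i⌋ := rfl
    rw [← this, h1]
    refine Int.floor_lt.2 ?_
    push_cast
    exact mul_lt_of_lt_one_right hp hxi.2
  have h4 := Int.floor_nonneg.1 h2
  have h5 := Int.floor_lt.1 h3
  push_cast at h5
  exact ⟨nonneg_of_mul_nonneg_right h4 hp, (mul_lt_iff_lt_one_right hp).1 h5⟩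

instance isProbabilityMeasure_unit_box :
    IsProbabilityMeasure (volume.restrict (box (0 : Fin d → ℝ) 1)) :=
  ⟨by simp [volume_box]⟩

/-- The conditional expectation is the mean over the dyadic cube. -/
lemma condExp_dyadic_mul {φ : EuclideanSpace ℝ (Fin d) → ℝ}
    (hφ : IntegrableOn φ (box (0 : Fin d → ℝ) 1)) (n : ℕ) {x : EuclideanSpace ℝ (Fin d)}
    (hx : x ∈ box (0 : Fin d → ℝ) 1) :
    ((volume.restrict (box (0 : Fin d → ℝ) 1))[φ | dyadicFiltration d n]) x *
        (((2 : ℝ) ^ n)⁻¹) ^ d =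
      ∫ y in box (fun i => (dyadicIndex n x i : ℝ) * ((2 : ℝ) ^ n)⁻¹) ((2 : ℝ) ^ n)⁻¹, φ y := by
  set μ := volume.restrict (box (0 : Fin d → ℝ) 1) with hμ
  set Q := box (fun i => (dyadicIndex n x i : ℝ) * ((2 : ℝ) ^ n)⁻¹) ((2 : ℝ) ^ n)⁻¹ with hQ
  have hQm : MeasurableSet[dyadicFiltration d n] Q := measurableSet_dyadic_box n x
  have hr : μ.restrict Q = volume.restrict Q := by
    rw [hμ, Measure.restrict_restrict (measurableSet_box _ _),
      Set.inter_eq_left.2 (dyadic_box_subset n hx)]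
  have h1 := setIntegral_condExp ((dyadicFiltration d).le n) hφ hQm
  rw [hr] at h1
  rw [← h1]
  -- A function measurable for the σ-algebra generated by the index is constant where the index is.
  have hconst : ∀ y ∈ Q, (μ[φ | dyadicFiltration d n]) y = (μ[φ | dyadicFiltration d n]) x := by
    intro y hy
    have hsm : StronglyMeasurable[dyadicFiltration d n] (μ[φ | dyadicFiltration d n]) :=
      stronglyMeasurable_condExp
    obtain ⟨t, -, ht⟩ := hsm.measurable
      (measurableSet_singleton ((μ[φ | dyadicFiltration d n]) x))
    have hxt : x ∈ dyadicIndex n ⁻¹' t := by rw [ht]; rfl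
    have hyt : y ∈ dyadicIndex n ⁻¹' t := by
      rw [Set.mem_preimage, (mem_box_dyadicIndex_iff n x y).1 hy]; exact hxt
    rw [ht] at hyt
    exact hyt
  rw [setIntegral_congr_fun (measurableSet_box _ _) hconst, setIntegral_const,
    volume_real_box _ (by positivity), smul_eq_mul, mul_comm]

end Dyadic

/-! ### Truncated odd integrals as an approximate martingale. -/

section HolderMartingale

variable {d : ℕ} {α : ℝ} {f : EuclideanSpace ℝ (Fin d) → ℝ}

/-- The constant in the comparison of truncated odd integrals with a dyadic martingale. -/
noncomputable def approxConst (d : ℕ) (α : ℝ) : ℝ :=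
  2 * (d * ballVol d / α) * d ^ α + 4 * d * (d + 1) ^ α * (d * ballVol d / (1 - α)) +
    2 * 2 ^ d * ballVol d + 1

/-- The odd integral over the part of the annulus with radii `ε` and `1` inside `A`. -/
noncomputable def truncOddInt (α : ℝ) (A : Set (EuclideanSpace ℝ (Fin d))) (ε : ℝ)
    (f : EuclideanSpace ℝ (Fin d) → ℝ) : EuclideanSpace ℝ (Fin d) → ℝ :=
  oddInt α (A ∩ annulus d ε 1) f

lemma truncOddInt_sub (hα0 : 0 < α) (hα1 : α < 1)
    (hf : ∀ x y, |f x - f y| ≤ ‖x - y‖ ^ α) {A : Set (EuclideanSpace ℝ (Fin d))}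
    (hA : MeasurableSet A) {a b : ℝ} (ha : 0 < a) (hab : a ≤ b) (x : EuclideanSpace ℝ (Fin d)) :
    truncOddInt α A a f x - truncOddInt α A b f x =
      oddInt α ((A ∩ annulus d a 1) \ (A ∩ annulus d b 1)) f x :=
  oddInt_diff hα0 hα1 hf ha (hA.inter (measurableSet_annulus _ _))
    (hA.inter (measurableSet_annulus _ _)) Set.inter_subset_right
    (fun _ hh => ⟨hh.1, hab.trans hh.2.1, hh.2.2⟩) x

lemma annulus_inter_diff_subset (A : Set (EuclideanSpace ℝ (Fin d))) (a b : ℝ) :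
    (A ∩ annulus d a 1) \ (A ∩ annulus d b 1) ⊆ annulus d a b := by
  rintro h ⟨⟨hA, h1, h2⟩, h3⟩
  refine ⟨h1, ?_⟩
  by_contra hcon
  exact h3 ⟨hA, (not_le.1 hcon).le, h2⟩

lemma abs_truncOddInt_sub_le (hα0 : 0 < α) (hα1 : α < 1)
    (hf : ∀ x y, |f x - f y| ≤ ‖x - y‖ ^ α) {A : Set (EuclideanSpace ℝ (Fin d))}
    (hA : MeasurableSet A) {a b : ℝ} (ha : 0 < a) (hab : a ≤ b) (hb : b ≤ 2 * a)
    (x : EuclideanSpace ℝ (Fin d)) :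
    |truncOddInt α A a f x - truncOddInt α A b f x| ≤ approxConst d α := by
  rw [truncOddInt_sub hα0 hα1 hf hA ha hab]
  refine (abs_oddInt_le hα1 hf ha (ha.le.trans hab) (annulus_inter_diff_subset A a b) x).trans ?_
  have hB := ballVol_nonneg d
  have h1 : 0 < 1 - α := by linarith
  have h2 : 2 * (b / a) ^ d * ballVol d ≤ 2 * 2 ^ d * ballVol d := by
    have : b / a ≤ 2 := by rwa [div_le_iff₀ ha]
    have : 0 ≤ b / a := div_nonneg (ha.le.trans hab) ha.le
    gcongr
  have h3 : 0 ≤ 2 * (d * ballVol d / α) * d ^ α := by positivity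
  have h4 : 0 ≤ 4 * d * (d + 1) ^ α * (d * ballVol d / (1 - α)) := by positivity
  unfold approxConst
  linarith

/-- On a dyadic cube of side `l`, split the integral truncated at `2 ^ (-N)` into the part truncated
at `l`, which oscillates boundedly, and the part over smaller increments, whose mean is bounded by
cancellation. The first three terms of `approxConst` are the oscillation, the cancellation and the
one-step increment. -/
lemma isApproxMartingale_truncOddInt (hd : 1 ≤ d) (hα0 : 0 < α) (hα1 : α < 1)
    (hf : ∀ x y, |f x - f y| ≤ ‖x - y‖ ^ α) {A : Set (EuclideanSpace ℝ (Fin d))}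
    (hA : MeasurableSet A) :
    IsApproxMartingale (fun n => truncOddInt α A ((2 : ℝ) ^ n)⁻¹ f) (dyadicFiltration d)
      (volume.restrict (box (0 : Fin d → ℝ) 1)) (approxConst d α) := by
  have hB := ballVol_nonneg d
  have h1α : 0 < 1 - α := by linarith
  have hc1 : 0 ≤ 2 * (d * ballVol d / α) * (d : ℝ) ^ α := by positivity
  have hc2 : 0 ≤ 4 * d * ((d : ℝ) + 1) ^ α * (d * ballVol d / (1 - α)) := by positivity
  have hc3 : 0 ≤ 2 * 2 ^ d * ballVol d := by positivity
  have hmeas : ∀ n : ℕ, Measurable (truncOddInt α A ((2 : ℝ) ^ n)⁻¹ f) := fun n =>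
    measurable_oddInt hα0 hf _
  have hbdd : ∀ n : ℕ, ∀ x, |truncOddInt α A ((2 : ℝ) ^ n)⁻¹ f x| ≤
      2 * (1 / ((2 : ℝ) ^ n)⁻¹) ^ d * ballVol d := fun n x =>
    abs_oddInt_le hα1 hf (by positivity) zero_le_one Set.inter_subset_right x
  have hint : ∀ n : ℕ, ∀ s : Set (EuclideanSpace ℝ (Fin d)), volume s ≠ ⊤ →
      IntegrableOn (truncOddInt α A ((2 : ℝ) ^ n)⁻¹ f) s := fun n s hs =>
    Measure.integrableOn_of_bounded hs (hmeas n).aestronglyMeasurable (ae_of_all _ (hbdd n))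
  have hfin : ∀ (c : Fin d → ℝ) (l : ℝ), volume (box c l) ≠ ⊤ := fun c l => by
    rw [volume_box]; exact (ENNReal.pow_lt_top ENNReal.ofReal_lt_top).ne
  refine ⟨by unfold approxConst; linarith, hmeas, ae_of_all _ fun x => ?_,
    fun n => ae_of_all _ fun x => ?_, fun N n hn => ?_⟩
  · refine (hbdd 0 x).trans ?_
    have : ballVol d ≤ 2 ^ d * ballVol d := le_mul_of_one_le_left hB (one_le_pow₀ one_le_two)
    simp only [pow_zero, inv_one, div_one, one_pow, mul_one]
    unfold approxConst
    linarith
  · have hp : (0 : ℝ) < 2 ^ n := by positivity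
    refine abs_truncOddInt_sub_le hα0 hα1 hf hA (by positivity) ?_ (le_of_eq ?_) x
    · gcongr
      · exact one_le_two
      · omega
    · rw [pow_succ]; field_simp
  · filter_upwards [ae_restrict_mem (measurableSet_box _ _)] with x hx
    set l : ℝ := ((2 : ℝ) ^ n)⁻¹ with hl
    have hl0 : 0 < l := by positivity
    set c : Fin d → ℝ := fun i => (dyadicIndex n x i : ℝ) * l with hc
    set S : Set (EuclideanSpace ℝ (Fin d)) :=
      (A ∩ annulus d ((2 : ℝ) ^ N)⁻¹ 1) \ (A ∩ annulus d l 1) with hS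
    have hlN : ((2 : ℝ) ^ N)⁻¹ ≤ l := by
      rw [hl]; gcongr; exact one_le_two
    have hxQ : x ∈ box c l := (mem_box_dyadicIndex_iff n x x).2 rfl
    have e1 := condExp_dyadic_mul (hint N _ (hfin 0 1)) n hx
    rw [← hl, ← hc] at e1
    have e2 : ∫ y in box c l, oddInt α S f y =
        (∫ y in box c l, truncOddInt α A ((2 : ℝ) ^ N)⁻¹ f y) -
          ∫ y in box c l, truncOddInt α A l f y := by
      rw [← integral_sub (hint N _ (hfin _ _)) (hint n _ (hfin _ _))]
      congr 1
      ext y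
      exact (truncOddInt_sub hα0 hα1 hf hA (by positivity) hlN y).symm
    have b1 : |∫ y in box c l, oddInt α S f y| ≤
        4 * d * ((d : ℝ) + 1) ^ α * (d * ballVol d / (1 - α)) * l ^ d := by
      refine (abs_setIntegral_oddInt_le hd hα0 hα1 hf (by positivity : 0 < ((2 : ℝ) ^ N)⁻¹) hlN
        ((hA.inter (measurableSet_annulus _ _)).diff (hA.inter (measurableSet_annulus _ _)))
        (annulus_inter_diff_subset A _ _) (hfin c l) (by positivity)
        (fun v hv => abs_setIntegral_translate_le hα0 hf c hl0 hv)).trans (le_of_eq ?_)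
      -- The powers `l ^ (d - 1)`, `l ^ α` and `l ^ (1 - α)` combine to the volume `l ^ d`.
      obtain ⟨k, rfl⟩ : ∃ k, d = k + 1 := ⟨d - 1, by omega⟩
      rw [Real.rpow_sub hl0, Real.rpow_one, Nat.add_sub_cancel, pow_succ]
      have : l ^ α ≠ 0 := (Real.rpow_pos_of_pos hl0 α).ne'
      field_simp
    have b2 : |(∫ y in box c l, truncOddInt α A l f y) - truncOddInt α A l f x * l ^ d| ≤
        2 * (d * ballVol d / α) * (d : ℝ) ^ α * l ^ d := by
      have h1 : truncOddInt α A l f x * l ^ d = ∫ _y in box c l, truncOddInt α A l f x := by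
        rw [setIntegral_const, volume_real_box _ hl0.le, smul_eq_mul, mul_comm]
      rw [h1, ← integral_sub (hint n _ (hfin _ _)) (integrableOn_const (hfin _ _)),
        ← volume_real_box c hl0.le, ← Real.norm_eq_abs]
      refine norm_setIntegral_le_of_norm_le_const (hfin _ _).lt_top fun y hy => ?_
      have hl1 : l ≤ 1 := inv_le_one_of_one_le₀ (one_le_pow₀ one_le_two)
      refine (abs_oddInt_sub_le hd hα0 hα1 hf hl0 hl1
        (hA.inter (measurableSet_annulus _ _)) Set.inter_subset_right y x).trans ?_
      gcongr
      rw [div_le_iff₀ hl0]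
      exact norm_sub_le_of_mem_box hl0.le hy hxQ
    have hld : 0 < l ^ d := pow_pos hl0 d
    -- Multiplying by the volume of the cube turns the conditional expectation into the integral in
    -- `e1`.
    rw [← mul_le_mul_iff_left₀ hld, ← abs_of_pos hld, ← abs_mul, abs_of_pos hld, sub_mul, e1]
    rw [e2] at b1
    have h5 := add_le_add b1 b2
    refine (abs_sub_le _ (∫ y in box c l, truncOddInt α A l f y) _).trans (h5.trans ?_)
    rw [← add_mul]
    gcongr
    unfold approxConst
    linarith

end HolderMartingale

/-! ### Behaviour under isometries and translations. -/

section Isometry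

variable {d : ℕ} {α : ℝ} {f : EuclideanSpace ℝ (Fin d) → ℝ}

/-- The linear part of an isometry of `ℝ^d`. -/
noncomputable def linearPart (φ : EuclideanSpace ℝ (Fin d) ≃ᵢ EuclideanSpace ℝ (Fin d)) :
    EuclideanSpace ℝ (Fin d) ≃ₗᵢ[ℝ] EuclideanSpace ℝ (Fin d) :=
  φ.toRealAffineIsometryEquiv.linearIsometryEquiv

lemma isometryEquiv_add (φ : EuclideanSpace ℝ (Fin d) ≃ᵢ EuclideanSpace ℝ (Fin d))
    (x h : EuclideanSpace ℝ (Fin d)) : φ (x + h) = φ x + linearPart φ h := by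
  have h1 := φ.toRealAffineIsometryEquiv.map_vadd x h
  rw [IsometryEquiv.coeFn_toRealAffineIsometryEquiv] at h1
  rw [add_comm x h, add_comm (φ x)]
  exact h1

lemma measurePreserving_isometryEquiv
    (φ : EuclideanSpace ℝ (Fin d) ≃ᵢ EuclideanSpace ℝ (Fin d)) :
    MeasurePreserving φ volume volume := by
  have h1 := (measurePreserving_add_left volume (φ 0)).comp (linearPart φ).measurePreserving
  have h2 : (φ : EuclideanSpace ℝ (Fin d) → EuclideanSpace ℝ (Fin d)) =
      (fun x => φ 0 + x) ∘ linearPart φ := by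
    ext1 x
    rw [Function.comp_apply, ← isometryEquiv_add, zero_add]
  rw [h2]
  exact h1

/-- The linear part turns the increments, so `A` becomes its preimage; estimates uniform in `A` and
in `f` thus pass to cubes of any position and orientation. -/
lemma truncOddInt_isometryEquiv (φ : EuclideanSpace ℝ (Fin d) ≃ᵢ EuclideanSpace ℝ (Fin d))
    (A : Set (EuclideanSpace ℝ (Fin d))) (ε : ℝ) (x : EuclideanSpace ℝ (Fin d)) :
    truncOddInt α A ε f (φ x) = truncOddInt α (linearPart φ ⁻¹' A) ε (f ∘ φ) x := by
  have h1 : linearPart φ ⁻¹' A ∩ annulus d ε 1 = linearPart φ ⁻¹' (A ∩ annulus d ε 1) := by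
    ext h
    simp only [annulus, Set.mem_inter_iff, Set.mem_preimage, Set.mem_ofPred_eq,
      LinearIsometryEquiv.norm_map]
  unfold truncOddInt oddInt
  rw [h1, ← (linearPart φ).measurePreserving.setIntegral_preimage_emb
    (linearPart φ).toHomeomorph.measurableEmbedding]
  congr 1
  ext h
  rw [Function.comp_apply, Function.comp_apply, sub_eq_add_neg x h, isometryEquiv_add,
    isometryEquiv_add, map_neg, LinearIsometryEquiv.norm_map, ← sub_eq_add_neg]

lemma truncOddInt_translate (v : EuclideanSpace ℝ (Fin d)) (A : Set (EuclideanSpace ℝ (Fin d)))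
    (ε : ℝ) (x : EuclideanSpace ℝ (Fin d)) :
    truncOddInt α A ε f (x + v) = truncOddInt α A ε (fun y => f (y + v)) x := by
  unfold truncOddInt oddInt
  congr 1
  ext h
  rw [add_right_comm, add_sub_right_comm]

end Isometry

/-! ### Both bounds for functions of Hölder constant one. -/

section UnitHolder

variable {d : ℕ} {α : ℝ} {f : EuclideanSpace ℝ (Fin d) → ℝ}

lemma approxConst_pos (hα0 : 0 < α) (hα1 : α < 1) : 0 < approxConst d α := by
  have hB := ballVol_nonneg d
  have h1 : 0 < 1 - α := by linarith
  unfold approxConst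
  positivity

lemma exists_dyadic_near {ε : ℝ} (h0 : 0 < ε) (h1 : ε < 1 / 2) :
    ∃ n : ℕ, 1 ≤ n ∧ ε ≤ ((2 : ℝ) ^ n)⁻¹ ∧ ((2 : ℝ) ^ n)⁻¹ ≤ 2 * ε ∧
      (n : ℝ) ≤ 2 * Real.log (1 / ε) := by
  obtain ⟨n, hn1, hn2⟩ := exists_nat_pow_near (x := 1 / ε) (y := (2 : ℝ))
    (by rw [le_div_iff₀ h0]; linarith) one_lt_two
  have hp : (0 : ℝ) < 2 ^ n := by positivity
  refine ⟨n, ?_, ?_, ?_, ?_⟩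
  -- The case `n = 0` would force `ε > 1 / 2`.
  · by_contra hcon
    have : n = 0 := by omega
    subst this
    rw [div_lt_iff₀ h0] at hn2
    norm_num at hn2
    linarith
  · rw [le_div_iff₀ h0] at hn1
    rw [le_inv_comm₀ h0 hp, ← one_div, le_div_iff₀ h0]
    exact hn1
  · rw [div_lt_iff₀ h0, pow_succ] at hn2
    rw [inv_le_iff_one_le_mul₀ hp]
    linarith
  · have h2 := Real.log_le_log hp hn1
    rw [Real.log_pow] at h2
    have h3 := Real.log_two_gt_d9
    have h4 : (n : ℝ) * (1 / 2) ≤ n * Real.log 2 := by gcongr; linarith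
    linarith

lemma truncOddInt_integrableOn_sq (hα0 : 0 < α) (hα1 : α < 1)
    (hf : ∀ x y, |f x - f y| ≤ ‖x - y‖ ^ α) (A : Set (EuclideanSpace ℝ (Fin d)))
    {ε : ℝ} (hε : 0 < ε) {s : Set (EuclideanSpace ℝ (Fin d))} (hs : volume s ≠ ⊤) :
    IntegrableOn (fun x => truncOddInt α A ε f x ^ 2) s := by
  refine Measure.integrableOn_of_bounded (M := (2 * (1 / ε) ^ d * ballVol d) ^ 2) hs
    ((measurable_oddInt hα0 hf _).pow_const 2).aestronglyMeasurable (ae_of_all _ fun x => ?_)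
  rw [norm_pow, Real.norm_eq_abs]
  have := abs_oddInt_le hα1 hf hε zero_le_one
    (Set.inter_subset_right : A ∩ annulus d ε 1 ⊆ annulus d ε 1) x
  gcongr
  exact this

/-- The constant in the mean square bound. -/
noncomputable def sqConst (d : ℕ) (α : ℝ) : ℝ :=
  4 * (8 * Real.exp (3 * approxConst d α + (3 * approxConst d α) ^ 2 / 2) +
    2 * approxConst d α ^ 2) + 4 * approxConst d α ^ 2

lemma setIntegral_truncOddInt_sq_le (hd : 1 ≤ d) (hα0 : 0 < α) (hα1 : α < 1)
    (hf : ∀ x y, |f x - f y| ≤ ‖x - y‖ ^ α) {A : Set (EuclideanSpace ℝ (Fin d))}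
    (hA : MeasurableSet A) {ε : ℝ} (h0 : 0 < ε) (h1 : ε < 1 / 2) :
    ∫ x in box (0 : Fin d → ℝ) 1, truncOddInt α A ε f x ^ 2 ≤
      sqConst d α * Real.log (1 / ε) := by
  obtain ⟨n, hn, hεn, hnε, hlog⟩ := exists_dyadic_near h0 h1
  have hM := isApproxMartingale_truncOddInt hd hα0 hα1 hf hA
  have hsq := hM.integral_sq_le hn
  set C := approxConst d α with hC
  have hC0 : 0 < C := approxConst_pos hα0 hα1
  have hn1 : (1 : ℝ) ≤ n := by exact_mod_cast hn
  have hfin : volume (box (0 : Fin d → ℝ) 1) ≠ ⊤ := by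
    rw [volume_box]; simp
  have hintn := truncOddInt_integrableOn_sq hα0 hα1 hf A
    (by positivity : 0 < ((2 : ℝ) ^ n)⁻¹) hfin
  have hpt : ∀ x, truncOddInt α A ε f x ^ 2 ≤
      2 * truncOddInt α A ((2 : ℝ) ^ n)⁻¹ f x ^ 2 + 2 * C ^ 2 := by
    intro x
    have h2 := abs_truncOddInt_sub_le hα0 hα1 hf hA h0 hεn hnε x
    have h3 : (truncOddInt α A ε f x - truncOddInt α A ((2 : ℝ) ^ n)⁻¹ f x) ^ 2 ≤ C ^ 2 := by
      rw [← sq_abs]; gcongr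
    nlinarith [sq_nonneg (truncOddInt α A ε f x - 2 * truncOddInt α A ((2 : ℝ) ^ n)⁻¹ f x)]
  set W := 8 * Real.exp (3 * C + (3 * C) ^ 2 / 2) + 2 * C ^ 2 with hW
  have hW0 : 0 ≤ W := by positivity
  calc ∫ x in box (0 : Fin d → ℝ) 1, truncOddInt α A ε f x ^ 2
      ≤ ∫ x in box (0 : Fin d → ℝ) 1,
          (2 * truncOddInt α A ((2 : ℝ) ^ n)⁻¹ f x ^ 2 + 2 * C ^ 2) :=
        integral_mono (truncOddInt_integrableOn_sq hα0 hα1 hf A h0 hfin)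
          ((hintn.const_mul 2).add (integrableOn_const hfin)) hpt
    _ = 2 * (∫ x in box (0 : Fin d → ℝ) 1, truncOddInt α A ((2 : ℝ) ^ n)⁻¹ f x ^ 2) +
          2 * C ^ 2 := by
        rw [integral_add (hintn.const_mul 2) (integrableOn_const hfin), integral_const_mul]
        simp
    _ ≤ 2 * (W * n) + 2 * C ^ 2 * n :=
        add_le_add (by gcongr) (le_mul_of_one_le_right (by positivity) hn1)
    _ = (2 * W + 2 * C ^ 2) * n := by ring
    _ ≤ (2 * W + 2 * C ^ 2) * (2 * Real.log (1 / ε)) := by gcongr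
    _ = sqConst d α * Real.log (1 / ε) := by rw [sqConst, hW]; ring

/-- Unit volume forces unit side since `d ≥ 1`; the half-open box then sits inside the closed one
with the same volume, so they differ by a null set. -/
lemma isCube_ae_eq {Q : Set (EuclideanSpace ℝ (Fin d))} (hd : 1 ≤ d) (hQ : IsCube Q)
    (hvol : volume Q = 1) :
    ∃ φ : EuclideanSpace ℝ (Fin d) ≃ᵢ EuclideanSpace ℝ (Fin d), φ ⁻¹' Q =ᵐ[volume] box 0 1 := by
  obtain ⟨s, hs, φ, rfl⟩ := hQ
  refine ⟨φ, ?_⟩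
  rw [Set.preimage_image_eq _ φ.injective]
  have h1 := (measurePreserving_isometryEquiv φ).measure_preimage_emb
    φ.toHomeomorph.measurableEmbedding (φ '' {x | ∀ i, 0 ≤ x i ∧ x i ≤ s})
  rw [Set.preimage_image_eq _ φ.injective, hvol] at h1
  have h2 := volume_euclidean_box (fun _ : Fin d => Set.Icc 0 s)
  have h3 : volume {x : EuclideanSpace ℝ (Fin d) | ∀ i, 0 ≤ x i ∧ x i ≤ s} =
      ENNReal.ofReal s ^ d := by
    refine h2.trans ?_
    simp
  have h4 : s = 1 := by
    rw [h3, ← ENNReal.ofReal_pow hs.le, ← ENNReal.ofReal_one,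
      ENNReal.ofReal_eq_ofReal_iff (by positivity) zero_le_one] at h1
    exact (pow_eq_one_iff_of_nonneg hs.le (by omega)).1 h1
  subst h4
  refine (ae_eq_of_subset_of_measure_ge ?_ ?_ (measurableSet_box _ _).nullMeasurableSet ?_).symm
  · intro x hx i
    have := hx i
    simp only [Pi.zero_apply, zero_add, Set.mem_Ico] at this
    exact ⟨this.1, this.2.le⟩
  · rw [h1, volume_box]; simp
  · rw [h1]; exact ENNReal.one_ne_top

lemma setIntegral_truncOddInt_sq_le_of_isCube (hd : 1 ≤ d) (hα0 : 0 < α) (hα1 : α < 1)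
    (hf : ∀ x y, |f x - f y| ≤ ‖x - y‖ ^ α) {A : Set (EuclideanSpace ℝ (Fin d))}
    (hA : MeasurableSet A) {ε : ℝ} (h0 : 0 < ε) (h1 : ε < 1 / 2)
    {Q : Set (EuclideanSpace ℝ (Fin d))} (hQ : IsCube Q) (hvol : volume Q = 1) :
    ∫ x in Q, truncOddInt α A ε f x ^ 2 ≤ sqConst d α * Real.log (1 / ε) := by
  obtain ⟨φ, hφ⟩ := isCube_ae_eq hd hQ hvol
  rw [← (measurePreserving_isometryEquiv φ).setIntegral_preimage_emb
    φ.toHomeomorph.measurableEmbedding, setIntegral_congr_set hφ]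
  simp_rw [truncOddInt_isometryEquiv φ]
  refine setIntegral_truncOddInt_sq_le hd hα0 hα1 (fun x y => ?_)
    ((linearPart φ).continuous.measurable hA) h0 h1
  refine (hf _ _).trans (le_of_eq ?_)
  rw [← dist_eq_norm, φ.dist_eq, dist_eq_norm]

/-- The constant in the almost everywhere bound. -/
noncomputable def lilConst (d : ℕ) (α : ℝ) : ℝ :=
  3 * ((3 * approxConst d α) ^ 2 / 2 + 2 + approxConst d α) + approxConst d α

lemma lilConst_pos (hα0 : 0 < α) (hα1 : α < 1) : 0 < lilConst d α := by
  have := approxConst_pos (d := d) hα0 hα1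
  unfold lilConst
  positivity

/-- Every large `L` lies in a dyadic block whose iterated logarithm is comparable with that
of `L`. -/
lemma exists_dyadic_block {L : ℝ} (hL : Real.exp 3 ≤ L) (j₀ : ℕ) (hj : 2 ^ j₀ ≤ L) :
    ∃ j ≥ j₀, 2 * L ≤ 2 ^ j ∧ (2 : ℝ) ^ j * Real.log j ≤ 8 * (L * Real.log (Real.log L)) := by
  have hL1 : 1 ≤ L := le_trans (Real.one_le_exp (by norm_num)) hL
  have hL0 : 0 < L := by linarith
  have hlog : 3 ≤ Real.log L := (Real.le_log_iff_exp_le hL0).2 hL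
  obtain ⟨i, hi1, hi2⟩ := exists_nat_pow_near hL1 one_lt_two
  -- `2 ^ (i + 1)` exceeds `L`; the additional doubling makes room for indices `n ≤ 2 * L`.
  refine ⟨i + 2, ?_, ?_, ?_⟩
  · have h1 : (2 : ℝ) ^ j₀ < 2 ^ (i + 1) := hj.trans_lt hi2
    have := (pow_lt_pow_iff_right₀ (one_lt_two (α := ℝ))).1 h1
    omega
  · rw [pow_succ] at hi2 ⊢
    linarith [hi2, pow_succ (2 : ℝ) i]
  · have h1 : (i : ℝ) ≤ 2 * Real.log L := by
      have h2 := Real.log_le_log (by positivity) hi1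
      rw [Real.log_pow] at h2
      have h3 := Real.log_two_gt_d9
      have h4 : (i : ℝ) * (1 / 2) ≤ i * Real.log 2 := by gcongr; linarith
      linarith
    have h5 : Real.log ((i + 2 : ℕ) : ℝ) ≤ 2 * Real.log (Real.log L) := by
      -- Here `log L ≥ 3` is used: `2 * log L + 2 ≤ (log L) ^ 2`.
      have h6 : ((i + 2 : ℕ) : ℝ) ≤ Real.log L ^ 2 := by push_cast; nlinarith
      have h7 := Real.log_le_log (by positivity) h6
      rw [Real.log_pow] at h7
      exact_mod_cast h7
    have h8 : (2 : ℝ) ^ (i + 2) ≤ 4 * L := by rw [pow_add]; linarith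
    have h9 : 0 ≤ Real.log ((i + 2 : ℕ) : ℝ) := Real.log_natCast_nonneg _
    calc (2 : ℝ) ^ (i + 2) * Real.log ((i + 2 : ℕ) : ℝ)
        ≤ (4 * L) * (2 * Real.log (Real.log L)) := by gcongr
      _ = _ := by ring

lemma tendsto_log_one_div : Tendsto (fun ε : ℝ => Real.log (1 / ε)) (𝓝[>] 0) atTop := by
  simp_rw [one_div]
  exact Real.tendsto_log_atTop.comp tendsto_inv_nhdsGT_zero

/-- The exceptional null set comes from the dyadic scales alone: passing from any `ε` to a
comparable `2 ^ (-n)` costs a constant at every point. -/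
lemma ae_unit_box_eventually_truncOddInt_le (hd : 1 ≤ d) (hα0 : 0 < α) (hα1 : α < 1)
    (hf : ∀ x y, |f x - f y| ≤ ‖x - y‖ ^ α) {A : Set (EuclideanSpace ℝ (Fin d))}
    (hA : MeasurableSet A) :
    ∀ᵐ x ∂(volume.restrict (box (0 : Fin d → ℝ) 1)), ∀ᶠ ε in 𝓝[>] (0 : ℝ),
      |truncOddInt α A ε f x| ≤ lilConst d α *
        √(Real.log (1 / ε) * Real.log (Real.log (Real.log (1 / ε)))) := by
  have hM := isApproxMartingale_truncOddInt hd hα0 hα1 hf hA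
  filter_upwards [hM.ae_eventually_le] with x hx
  obtain ⟨j₀, hj₀⟩ := eventually_atTop.1 hx
  have hC := approxConst_pos (d := d) hα0 hα1
  have hε : ∀ᶠ ε in 𝓝[>] (0 : ℝ), 0 < ε ∧ ε < 1 / 2 := by
    filter_upwards [Ioo_mem_nhdsGT (by norm_num : (0 : ℝ) < 1 / 2)] with ε hε using hε
  filter_upwards [hε, tendsto_log_one_div.eventually_ge_atTop (Real.exp 3),
    tendsto_log_one_div.eventually_ge_atTop (2 ^ j₀)] with ε hε hL hLj
  obtain ⟨n, -, hεn, hnε, hnlog⟩ := exists_dyadic_near hε.1 hε.2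
  set L := Real.log (1 / ε) with hLdef
  obtain ⟨j, hj, h2L, hjL⟩ := exists_dyadic_block hL j₀ hLj
  have hn : n ≤ 2 ^ j := by exact_mod_cast hnlog.trans h2L
  have h1 := hj₀ j hj n hn
  have h2 := abs_truncOddInt_sub_le hα0 hα1 hf hA hε.1 hεn hnε x
  set C := approxConst d α with hCdef
  have hL0 : 0 < L := (Real.exp_pos 3).trans_le hL
  have hlog3 : 3 ≤ Real.log L := (Real.le_log_iff_exp_le hL0).2 hL
  have hloglog : 1 ≤ Real.log (Real.log L) := by
    rw [Real.le_log_iff_exp_le (by linarith)]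
    linarith [Real.exp_one_lt_d9]
  have hL1 : 1 ≤ L := le_trans (Real.one_le_exp (by norm_num)) hL
  have h3 : 1 ≤ √(L * Real.log (Real.log L)) := by
    rw [Real.one_le_sqrt]; nlinarith
  have h4 : √(2 ^ j * Real.log j) ≤ 3 * √(L * Real.log (Real.log L)) := by
    -- The factor `3` bounds the `√8` coming from `exists_dyadic_block`.
    rw [show (3 : ℝ) = √9 by rw [show (9 : ℝ) = 3 ^ 2 by norm_num]; simp,
      ← Real.sqrt_mul (by norm_num)]
    exact Real.sqrt_le_sqrt (by nlinarith)
  have h5 : |truncOddInt α A ε f x| ≤ |truncOddInt α A ((2 : ℝ) ^ n)⁻¹ f x| + C := by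
    have := abs_add_le (truncOddInt α A ε f x - truncOddInt α A ((2 : ℝ) ^ n)⁻¹ f x)
      (truncOddInt α A ((2 : ℝ) ^ n)⁻¹ f x)
    rw [sub_add_cancel] at this
    linarith
  calc |truncOddInt α A ε f x| ≤ ((3 * C) ^ 2 / 2 + 2 + C) * √(2 ^ j * Real.log j) + C :=
        h5.trans (by gcongr)
    _ ≤ ((3 * C) ^ 2 / 2 + 2 + C) * (3 * √(L * Real.log (Real.log L))) +
        C * √(L * Real.log (Real.log L)) :=
        add_le_add (by gcongr) (le_mul_of_one_le_right hC.le h3)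
    _ = _ := by rw [lilConst]; ring

lemma ae_eventually_truncOddInt_le (hd : 1 ≤ d) (hα0 : 0 < α) (hα1 : α < 1)
    (hf : ∀ x y, |f x - f y| ≤ ‖x - y‖ ^ α) {A : Set (EuclideanSpace ℝ (Fin d))}
    (hA : MeasurableSet A) :
    ∀ᵐ x, ∀ᶠ ε in 𝓝[>] (0 : ℝ), |truncOddInt α A ε f x| ≤ lilConst d α *
      √(Real.log (1 / ε) * Real.log (Real.log (Real.log (1 / ε)))) := by
  -- Countably many integer translates of the unit box cover the space.
  have key : ∀ k : Fin d → ℤ, ∀ᵐ x : EuclideanSpace ℝ (Fin d),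
      x - WithLp.toLp 2 (fun i => (k i : ℝ)) ∈ box (0 : Fin d → ℝ) 1 →
      ∀ᶠ ε in 𝓝[>] (0 : ℝ), |truncOddInt α A ε f x| ≤ lilConst d α *
        √(Real.log (1 / ε) * Real.log (Real.log (Real.log (1 / ε)))) := by
    intro k
    set v : EuclideanSpace ℝ (Fin d) := WithLp.toLp 2 (fun i => (k i : ℝ)) with hv
    have h1 := ae_unit_box_eventually_truncOddInt_le hd hα0 hα1 (f := fun y => f (y + v))
      (fun x y => by simpa using hf (x + v) (y + v)) hA
    rw [ae_restrict_iff' (measurableSet_box _ _)] at h1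
    have h2 := (measurePreserving_sub_right volume v).quasiMeasurePreserving.ae h1
    filter_upwards [h2] with x hx hxv
    have h3 := hx hxv
    simp_rw [← truncOddInt_translate, sub_add_cancel] at h3
    exact h3
  filter_upwards [ae_all_iff.2 key] with x hx
  refine hx (fun i => ⌊x i⌋) fun i => ?_
  simp only [Pi.zero_apply, zero_add, Set.mem_Ico, PiLp.sub_apply]
  exact ⟨by linarith [Int.floor_le (x i)], by linarith [Int.lt_floor_add_one (x i)]⟩

end UnitHolder

/-! ### Scaling by the Hölder norm and conclusion. -/

section Main

variable {d : ℕ} {α : ℝ≥0} {f : EuclideanSpace ℝ (Fin d) → ℝ}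

lemma truncOddInt_const_mul (β r : ℝ) (A : Set (EuclideanSpace ℝ (Fin d))) (ε : ℝ)
    (g : EuclideanSpace ℝ (Fin d) → ℝ) (x : EuclideanSpace ℝ (Fin d)) :
    truncOddInt β A ε (fun y => r * g y) x = r * truncOddInt β A ε g x := by
  unfold truncOddInt oddInt
  rw [← integral_const_mul]
  congr 1
  ext h
  ring

/-- A Hölder function is its Hölder norm times a function of Hölder constant one. -/
lemma MemHolder.exists_eq_norm_mul (hf : MemHolder α f) :
    ∃ g : EuclideanSpace ℝ (Fin d) → ℝ, (∀ x y, |g x - g y| ≤ ‖x - y‖ ^ (α : ℝ)) ∧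
      ∃ b : ℝ, f = fun x => (nnHolderNorm α f : ℝ) * g x + b := by
  have h1 : ∀ x y, |f x - f y| ≤ nnHolderNorm α f * ‖x - y‖ ^ (α : ℝ) := fun x y => by
    have := hf.holderWith.dist_le x y
    rwa [Real.dist_eq, dist_eq_norm] at this
  -- When the norm vanishes one cannot divide by it, but `f` is constant and `g = 0` serves.
  rcases eq_or_lt_of_le (nnHolderNorm α f).coe_nonneg with h0 | h0
  · refine ⟨fun _ => 0, fun x y => ?_, f 0, ?_⟩
    · rw [sub_self, abs_zero]; positivity
    · ext x
      have h2 := h1 x 0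
      rw [← h0, zero_mul, abs_nonpos_iff, sub_eq_zero] at h2
      rw [h2]; simp
  · refine ⟨fun x => f x / nnHolderNorm α f, fun x y => ?_, 0, ?_⟩
    · rw [← sub_div, abs_div, abs_of_pos h0, div_le_iff₀ h0, mul_comm]
      exact h1 x y
    · ext x
      field_simp
      ring

lemma truncOddInt_add_const (β b : ℝ) (A : Set (EuclideanSpace ℝ (Fin d))) (ε : ℝ)
    (g : EuclideanSpace ℝ (Fin d) → ℝ) (x : EuclideanSpace ℝ (Fin d)) :
    truncOddInt β A ε (fun y => g y + b) x = truncOddInt β A ε g x := by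
  unfold truncOddInt oddInt
  congr 1
  ext h
  rw [add_sub_add_right_eq_sub]

/-- The mean square bound and the law of the iterated logarithm for the odd integral over a
measurable set of increments. -/
lemma MemHolder.truncOddInt_bounds (hd : 1 ≤ d) (hα0 : 0 < α) (hα1 : α < 1)
    (hf : MemHolder α f) {A : Set (EuclideanSpace ℝ (Fin d))} (hA : MeasurableSet A) :
    (∀ ε : ℝ, 0 < ε → ε < 1 / 2 →
      ∀ Q : Set (EuclideanSpace ℝ (Fin d)), IsCube Q → volume Q = 1 →
        IntegrableOn (fun x => |truncOddInt α A ε f x| ^ 2) Q ∧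
        ∫ x in Q, |truncOddInt α A ε f x| ^ 2 ≤
          max (sqConst d α) (lilConst d α) * Real.log (1 / ε) * (nnHolderNorm α f : ℝ) ^ 2) ∧
    ∀ᵐ x : EuclideanSpace ℝ (Fin d),
      limsup (fun ε : ℝ =>
          ((|truncOddInt α A ε f x| /
            √(Real.log (1 / ε) * Real.log (Real.log (Real.log (1 / ε)))) : ℝ) : EReal))
        (𝓝[>] 0) ≤
        ((max (sqConst d α) (lilConst d α) * (nnHolderNorm α f : ℝ) : ℝ) : EReal) := by
  have hα0' : (0 : ℝ) < α := hα0
  have hα1' : (α : ℝ) < 1 := hα1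
  obtain ⟨g, hg, b, hfg⟩ := hf.exists_eq_norm_mul
  set H : ℝ := (nnHolderNorm α f : ℝ) with hH
  have hH0 : 0 ≤ H := (nnHolderNorm α f).coe_nonneg
  have hT : ∀ ε x, truncOddInt α A ε f x = H * truncOddInt α A ε g x := fun ε x => by
    rw [hfg, truncOddInt_add_const, truncOddInt_const_mul]
  constructor
  · intro ε h0 h1 Q hQ hvol
    simp_rw [hT, sq_abs, mul_pow]
    have hlog : 0 ≤ Real.log (1 / ε) :=
      Real.log_nonneg (by rw [le_div_iff₀ h0]; linarith)
    refine ⟨(truncOddInt_integrableOn_sq hα0' hα1' hg A h0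
      (by rw [hvol]; exact ENNReal.one_ne_top)).const_mul _, ?_⟩
    rw [integral_const_mul, mul_comm]
    gcongr
    refine (setIntegral_truncOddInt_sq_le_of_isCube hd hα0' hα1' hg hA h0 h1 hQ hvol).trans ?_
    gcongr
    exact le_max_left _ _
  · filter_upwards [ae_eventually_truncOddInt_le hd hα0' hα1' hg hA] with x hx
    refine limsup_le_of_le (by isBoundedDefault) ?_
    filter_upwards [hx] with ε hε
    rw [EReal.coe_le_coe_iff, hT, abs_mul, abs_of_nonneg hH0]
    have hc : 0 ≤ lilConst d α := (lilConst_pos hα0' hα1').le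
    refine div_le_of_le_mul₀ (Real.sqrt_nonneg _)
      (mul_nonneg (hc.trans (le_max_right _ _)) hH0) ?_
    calc H * |truncOddInt α A ε g x| ≤ H * (lilConst d α *
          √(Real.log (1 / ε) * Real.log (Real.log (Real.log (1 / ε))))) := by gcongr
      _ ≤ H * (max (sqConst d α) (lilConst d α) *
          √(Real.log (1 / ε) * Real.log (Real.log (Real.log (1 / ε))))) := by
        gcongr
        exact le_max_right _ _
      _ = _ := by ring

lemma theta_eq_truncOddInt (α : ℝ≥0) (ε : ℝ) (f : EuclideanSpace ℝ (Fin d) → ℝ) :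
    theta α ε f = truncOddInt α Set.univ ε f := by
  ext x
  rw [truncOddInt, Set.univ_inter]
  rfl

lemma halfTheta_eq_truncOddInt (e : EuclideanSpace ℝ (Fin d)) (α : ℝ≥0) (ε : ℝ)
    (f : EuclideanSpace ℝ (Fin d) → ℝ) :
    halfTheta e α ε f = truncOddInt α {h | 0 < inner ℝ e h} ε f := by
  ext x
  rw [truncOddInt, Set.inter_comm]
  rfl

end Main

theorem theorem6p1 (d : ℕ) (hd : 1 ≤ d) (α : ℝ≥0) (hα0 : 0 < α) (hα1 : α < 1) :
    ∃ c : ℝ, 0 < c ∧ ∀ f : EuclideanSpace ℝ (Fin d) → ℝ, MemHolder α f →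
      -- the bounds for the whole annulus
      ((∀ ε : ℝ, 0 < ε → ε < 1 / 2 →
          ∀ Q : Set (EuclideanSpace ℝ (Fin d)), IsCube Q → volume Q = 1 →
            IntegrableOn (fun x => |theta α ε f x| ^ 2) Q ∧
            ∫ x in Q, |theta α ε f x| ^ 2 ≤ c * Real.log (1 / ε) * (nnHolderNorm α f : ℝ) ^ 2) ∧
        ∀ᵐ x : EuclideanSpace ℝ (Fin d),
          limsup (fun ε : ℝ =>
              ((|theta α ε f x| /
                √(Real.log (1 / ε) * Real.log (Real.log (Real.log (1 / ε)))) : ℝ) : EReal))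
            (𝓝[>] 0) ≤ ((c * (nnHolderNorm α f : ℝ) : ℝ) : EReal)) ∧
      -- the bounds for every half annulus
      ∀ e : EuclideanSpace ℝ (Fin d), ‖e‖ = 1 →
        (∀ ε : ℝ, 0 < ε → ε < 1 / 2 →
          ∀ Q : Set (EuclideanSpace ℝ (Fin d)), IsCube Q → volume Q = 1 →
            IntegrableOn (fun x => |halfTheta e α ε f x| ^ 2) Q ∧
            ∫ x in Q, |halfTheta e α ε f x| ^ 2 ≤
              c * Real.log (1 / ε) * (nnHolderNorm α f : ℝ) ^ 2) ∧
        ∀ᵐ x : EuclideanSpace ℝ (Fin d),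
          limsup (fun ε : ℝ =>
              ((|halfTheta e α ε f x| /
                √(Real.log (1 / ε) * Real.log (Real.log (Real.log (1 / ε)))) : ℝ) : EReal))
            (𝓝[>] 0) ≤ ((c * (nnHolderNorm α f : ℝ) : ℝ) : EReal) := by
  -- Neither constant depends on the set of increments, so one `c` serves the annulus and every half
  -- annulus.
  refine ⟨max (sqConst d α) (lilConst d α),
    lt_max_of_lt_right (lilConst_pos (NNReal.coe_pos.2 hα0) (by exact_mod_cast hα1)),
    fun f hf => ⟨?_, fun e _ => ?_⟩⟩
  · simp_rw [theta_eq_truncOddInt]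
    exact hf.truncOddInt_bounds hd hα0 hα1 MeasurableSet.univ
  · simp_rw [halfTheta_eq_truncOddInt]
    exact hf.truncOddInt_bounds hd hα0 hα1
      (isOpen_lt continuous_const (continuous_const.inner continuous_id)).measurableSet
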